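/- **Setting.** Let $E\subset\,]0,1]$ be a set of parameters with $0\in\overline E$ (for instance $E=\,]0,1]$ or $E=\{1/n: n\ge1\}$); all limits $\varepsilon\to0^+$ are taken within $E$. For $\varepsilon\in E$ let $\ell_\varepsilon>0$ and $\alpha_\varepsilon\ge0$, with $\ell_\varepsilon$ decreasing to $0$ as $\varepsilon\to0^+$. Put $\Omega_\varepsilon=\mathbb R^2\times\,]-\ell_\varepsilon,\ell_\varepsilon[$, write $x=(x_h,x_3)$, let $n=\pm e_3$ be the exterior normal on $\partial\Omega_\varepsilon=\mathbb R^2\times\{\pm\ell_\varepsilon\}$, and for a function $f$ on $\Omega_\varepsilon$ let $\overline f(x_h)=\frac1{2\ell_\varepsilon}\int_{-\ell_\varepsilon}^{\ell_\varepsilon}f(x_h,x_3)\,dx_3$ be its vertical average. Consider on $\mathbb R_+\times\Omega_\varepsilon$ the system $$\partial_t\rho_\varepsilon+\operatorname{div}(\rho_\varepsilon u_\varepsilon)=0,\qquad \partial_t(\rho_\varepsilon u_\varepsilon)+\operatorname{div}(\rho_\varepsilon u_\varepsilon\otimes u_\varepsilon)-\Delta u_\varepsilon+\tfrac1\varepsilon\nabla\pi_\varepsilon+\tfrac1\varepsilon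 e_3\times\rho_\varepsilon u_\varepsilon=0,\qquad \operatorname{div}u_\varepsilon=0,$$ with the Navier-slip conditions $u_\varepsilon\cdot n=0$ and $(\mathbb Du_\varepsilon)n\times n=-\alpha_\varepsilon u_\varepsilon\times n$ on $\partial\Omega_\varepsilon$, where $\mathbb Du$ is the symmetric part of the Jacobian matrix $Du$, and with initial datum $(\rho_\varepsilon,\rho_\varepsilon u_\varepsilon)_{|t=0}=(\rho^{in}_\varepsilon,m^{in}_\varepsilon)$. A pair $(\rho_\varepsilon,u_\varepsilon)$ is a *global in time finite energy weak solution* if, for every $T>0$: * $0\le\rho_\varepsilon\in L^\infty([0,T[\times\Omega_\varepsilon)$, and $u_\varepsilon\in L^\infty([0,T[;L^2(\Omega_\varepsilon))\cap L^2([0,T[;H^1(\Omega_\varepsilon))$ with $\operatorname{div}u_\varepsilon=0$ in $\Omega_\varepsilon$ and $u_\varepsilon\cdot n=0$ on $\partial\Omega_\varepsilon$; * for all $\beta\in C^1_b(\mathbb R)$ and $\varphi\in C_c^\infty(\mathbb R_+\times\overline{\Omega_\varepsilon})$, $$-\iint_{\mathbb R_+\times\Omega_\varepsilon}\beta(\rho_\varepsilon)(\partial_t\varphi+u_\varepsilon\cdot\nabla\varphi)\,dx\,dt=\int_{\Omega_\varepsilon}\beta(\rho_\varepsilon^{in})\varphi(0,\cdot)\,dx;$$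 * for all $\psi\in C_c^\infty(\mathbb R_+\times\overline{\Omega_\varepsilon};\mathbb R^3)$ with $\operatorname{div}\psi=0$ and $\psi\cdot n=0$ on $\partial\Omega_\varepsilon$, $$\iint_{\mathbb R_+\times\Omega_\varepsilon}\Big(-\rho_\varepsilon u_\varepsilon\cdot\partial_t\psi-\rho_\varepsilon u_\varepsilon\otimes u_\varepsilon:\nabla\psi+\tfrac1\varepsilon e_3\times\rho_\varepsilon u_\varepsilon\cdot\psi+\nabla u_\varepsilon:\nabla\psi\Big)dx\,dt+2\alpha_\varepsilon\iint_{\mathbb R_+\times\partial\Omega_\varepsilon}u_\varepsilon\cdot\psi\,dx_h\,dt=\int_{\Omega_\varepsilon}m_\varepsilon^{in}\cdot\psi(0,\cdot)\,dx;$$ * for almost every $t\in[0,T[$, $$\tfrac12\int_{\Omega_\varepsilon}\rho_\varepsilon(t)|u_\varepsilon(t)|^2dx+\int_0^t\!\!\int_{\Omega_\varepsilon}|Du_\varepsilon|^2dx\,d\tau+2\alpha_\varepsilon\int_0^t\!\!\int_{\partial\Omega_\varepsilon}|u_\varepsilon|^2dx_h\,d\tau\le\int_{\Omega_\varepsilon}\frac{|m^{in}_\varepsilon|^2}{\rho^{in}_\varepsilon}dx.$$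 **Assumptions on the data.** Let $\rho^{in}_\varepsilon(x)=\rho^{in}_0(x_h)+\varepsilon\,r^{in}_\varepsilon(x)$, where $\rho_0^{in}\in C^2(\mathbb R^2)\cap W^{2,\infty}(\mathbb R^2)$ is not constant, and suppose that there is a constant $\rho^*>0$ with $0\le\rho_0^{in}\le\rho^*$ and $0\le\rho_\varepsilon^{in}\le2\rho^*$ for all $\varepsilon\in E$. Suppose that for each $\varepsilon\in E$ there is $\delta_\varepsilon>0$ with $\frac1{\rho^{in}_\varepsilon}\mathbf 1_{\{\rho_\varepsilon^{in}\le\delta_\varepsilon\}}\in L^1(\Omega_\varepsilon)$, that $m_\varepsilon^{in}\in L^2(\Omega_\varepsilon;\mathbb R^3)$, that $m_\varepsilon^{in}=0$ where $\rho_\varepsilon^{in}=0$, and that $|m_\varepsilon^{in}|^2/\rho_\varepsilon^{in}\in L^1(\Omega_\varepsilon)$. Suppose that, uniformly in $\varepsilon\in E$: $(\overline{r^{in}_\varepsilon})$ is bounded in $L^\infty(\mathbb R^2)\cap H^{-2}(\mathbb R^2)$; $(\overline{m_\varepsilon^{in}})$ is bounded in $L^2(\mathbb R^2)$; $\frac1{2\ell_\varepsilon}\int_{\Omega_\varepsilon}|m_\varepsilon^{in}|^2/\rho_\varepsilon^{in}\,dx\le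 C$; and, for some $\delta>0$, the averages of $\frac1{\rho_\varepsilon^{in}}\mathbf 1_{\{\rho_\varepsilon^{in}\le\delta\}}$ are bounded in $L^1(\mathbb R^2)$. Finally suppose that, for every compact $K\subset\mathbb R^2$, the Lebesgue measure of $\{y\in K:|\nabla_h\rho_0^{in}(y)|\le\delta\}$ tends to $0$ as $\delta\to0^+$. **Theorem.** Assume that $\alpha_\varepsilon/\ell_\varepsilon\to+\infty$ as $\varepsilon\to0^+$, and for every $\varepsilon\in E$ let $(\rho_\varepsilon,u_\varepsilon)$ be a global in time finite energy weak solution related to the initial datum $(\rho_\varepsilon^{in},m_\varepsilon^{in})$. Then, for every $T>0$, as $\varepsilon\to0^+$: 1. $\overline{\rho_\varepsilon}\rightharpoonup\rho_0^{in}$ weakly-$*$ in $L^\infty([0,T]\times\mathbb R^2)$; 2. after modification on a null set of times, $\overline{\rho_\varepsilon}\to\rho_0^{in}$ in $C^0([0,T];L^p_w(K))$ for every compact $K\subset\mathbb R^2$ and every $1\le p<+\infty$; that is, for every $\varphi$ in the dual $L^{p'}(K)$, $1/p+1/p'=1$, the functions $t\mapsto\int_K\overline{\rho_\varepsilon}(t)\varphi\,dx_h$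 are continuous on $[0,T]$ and converge to $\int_K\rho_0^{in}\varphi\,dx_h$ uniformly on $[0,T]$; 3. $\overline{u_\varepsilon}\to0$ strongly in $L^2([0,T];L^2(\mathbb R^2))$. -/

import Mathlib

open MeasureTheory Set Filter Topology
open scoped ENNReal ContDiff

noncomputable section

/-- The horizontal plane `ℝ²`. -/
abbrev Plane : Type := EuclideanSpace ℝ (Fin 2)

/-- Points `x = (x_h, x_3)` of physical space `ℝ³ = ℝ² × ℝ`, with product Lebesgue measure. -/
abbrev Space3 : Type := Plane × ℝ

/-- Values of vector fields: `ℝ³` with its Euclidean structure. -/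
abbrev Vec3 : Type := EuclideanSpace ℝ (Fin 3)

/-- The slab `Ω = ℝ² × ]-ℓ, ℓ[`. -/
def slab (ℓ : ℝ) : Set Space3 := univ ×ˢ Ioo (-ℓ) ℓ

/-- Lebesgue measure on the slab. -/
def slabMeasure (ℓ : ℝ) : Measure Space3 := volume.restrict (slab ℓ)

/-- Lebesgue measure on the cylinder `]0,T[ × Ω`. -/
def cylMeasure (ℓ T : ℝ) : Measure (ℝ × Space3) := volume.restrict (Ioo 0 T ×ˢ slab ℓ)

/-- Lebesgue measure on `]0,T[ × ℝ²`. -/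
def planeCylMeasure (T : ℝ) : Measure (ℝ × Plane) := volume.restrict (Ioo 0 T ×ˢ univ)

/-- The coordinate directions `e₁, e₂, e₃` of `ℝ³`. -/
def dir : Fin 3 → Space3 :=
  ![(EuclideanSpace.single 0 1, 0), (EuclideanSpace.single 1 1, 0), (0, 1)]

/-- The classical partial derivative `∂_j f`. -/
def pd {F : Type*} [NormedAddCommGroup F] [NormedSpace ℝ F] (j : Fin 3) (f : Space3 → F)
    (x : Space3) : F := fderiv ℝ f x (dir j)

/-- Smooth functions with compact support on a normed space. Restricting such functions to
a closed slab, or to `[0,∞[` times a closed slab, gives the test functions that are smooth up to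
the boundary. -/
def IsTest {X F : Type*} [NormedAddCommGroup X] [NormedSpace ℝ X] [NormedAddCommGroup F]
    [NormedSpace ℝ F] (φ : X → F) : Prop := ContDiff ℝ ∞ φ ∧ HasCompactSupport φ

/-- The vertical average `f̄(x_h) = (2ℓ)⁻¹ ∫_{-ℓ}^{ℓ} f(x_h, x_3) dx_3`. -/
def vAvg {F : Type*} [NormedAddCommGroup F] [NormedSpace ℝ F] (ℓ : ℝ) (f : Space3 → F)
    (xh : Plane) : F := (2 * ℓ)⁻¹ • ∫ z in Ioo (-ℓ) ℓ, f (xh, z)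

/-- `G j = ∂_j v` in the sense of distributions on the slab, for `j = 1, 2, 3`. -/
def IsWeakGradient (ℓ : ℝ) (v : Space3 → Vec3) (G : Space3 → Fin 3 → Vec3) : Prop :=
  ∀ φ : Space3 → ℝ, IsTest φ → tsupport φ ⊆ slab ℓ → ∀ j : Fin 3,
    ∫ x in slab ℓ, pd j φ x • v x = - ∫ x in slab ℓ, φ x • G x j

/-- `γp` and `γm` are the traces of `v` on the faces `x_3 = ℓ` and `x_3 = -ℓ`, where `G` is the weak
gradient of `v`: Green's formula in the vertical direction, tested with functions that need not
vanish on the boundary. -/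
def IsTrace (ℓ : ℝ) (v : Space3 → Vec3) (G : Space3 → Fin 3 → Vec3) (γp γm : Plane → Vec3) :
    Prop :=
  ∀ φ : Space3 → ℝ, IsTest φ →
    ∫ x in slab ℓ, (pd 2 φ x • v x + φ x • G x 2)
      = ∫ y : Plane, (φ (y, ℓ) • γp y - φ (y, -ℓ) • γm y)

/-- `div v = 0` in the slab and `v · n = 0` on its boundary, in the weak sense appropriate for
square integrable fields. -/
def IsSolenoidalTangent (ℓ : ℝ) (v : Space3 → Vec3) : Prop :=
  ∀ φ : Space3 → ℝ, IsTest φ → ∫ x in slab ℓ, ∑ j : Fin 3, v x j * pd j φ x = 0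

/-- The function spaces for the velocity `u`, its spatial gradient `Du` (`Du t x j = ∂_j u`) and its
traces `γp, γm` on the two faces:
`u ∈ L^∞(0,T; L²_σ) ∩ L²(0,T; H¹)` for every `T > 0`. -/
structure IsVelocity (ℓ : ℝ) (u : ℝ → Space3 → Vec3) (Du : ℝ → Space3 → Fin 3 → Vec3)
    (γp γm : ℝ → Plane → Vec3) : Prop where
  memLp : ∀ T : ℝ, 0 < T → MemLp (fun q : ℝ × Space3 => u q.1 q.2) 2 (cylMeasure ℓ T)
  bounded : ∀ T : ℝ, 0 < T → ∃ C : ℝ, ∀ᵐ t ∂(volume.restrict (Ioo 0 T)),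
    MemLp (u t) 2 (slabMeasure ℓ) ∧ ∫ x in slab ℓ, ‖u t x‖ ^ 2 ≤ C
  solenoidal : ∀ᵐ t ∂(volume.restrict (Ioi (0 : ℝ))), IsSolenoidalTangent ℓ (u t)
  grad_memLp : ∀ T : ℝ, 0 < T → ∀ j : Fin 3,
    MemLp (fun q : ℝ × Space3 => Du q.1 q.2 j) 2 (cylMeasure ℓ T)
  grad : ∀ᵐ t ∂(volume.restrict (Ioi (0 : ℝ))), IsWeakGradient ℓ (u t) (Du t)
  trace_memLp : ∀ T : ℝ, 0 < T → MemLp (fun q : ℝ × Plane => γp q.1 q.2) 2 (planeCylMeasure T) ∧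
    MemLp (fun q : ℝ × Plane => γm q.1 q.2) 2 (planeCylMeasure T)
  trace : ∀ᵐ t ∂(volume.restrict (Ioi (0 : ℝ))), IsTrace ℓ (u t) (Du t) (γp t) (γm t)

/-- `C¹_b(ℝ)`. -/
def IsC1b (β : ℝ → ℝ) : Prop :=
  ContDiff ℝ 1 β ∧ ∃ C : ℝ, ∀ s, |β s| ≤ C ∧ |deriv β s| ≤ C

/-- The mass equation with initial datum `ρin`, in the renormalised sense. -/
def SolvesMass (ℓ : ℝ) (ρin : Space3 → ℝ) (ρ : ℝ → Space3 → ℝ) (u : ℝ → Space3 → Vec3) : Prop :=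
  ∀ β : ℝ → ℝ, IsC1b β → ∀ φ : ℝ × Space3 → ℝ, IsTest φ →
    - ∫ t in Ioi (0 : ℝ), ∫ x in slab ℓ, β (ρ t x) *
        (deriv (fun s => φ (s, x)) t + ∑ j : Fin 3, u t x j * pd j (fun y => φ (t, y)) x)
      = ∫ x in slab ℓ, β (ρin x) * φ (0, x)

/-- The momentum equation with Coriolis force `ε⁻¹ e₃ × ρ u`, Navier-slip coefficient `α` and
initial momentum `m`, tested with divergence-free fields tangent to the boundary. -/
def SolvesMomentum (ε ℓ α : ℝ) (m : Space3 → Vec3) (ρ : ℝ → Space3 → ℝ)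
    (u : ℝ → Space3 → Vec3) (Du : ℝ → Space3 → Fin 3 → Vec3) (γp γm : ℝ → Plane → Vec3) : Prop :=
  ∀ ψ : ℝ × Space3 → Vec3, IsTest ψ →
    (∀ t, 0 ≤ t → ∀ x ∈ slab ℓ, ∑ j : Fin 3, pd j (fun y => ψ (t, y)) x j = 0) →
    (∀ t, 0 ≤ t → ∀ y : Plane, ψ (t, (y, ℓ)) 2 = 0 ∧ ψ (t, (y, -ℓ)) 2 = 0) →
    (∫ t in Ioi (0 : ℝ), ∫ x in slab ℓ,
        (- ρ t x * inner ℝ (u t x) (deriv (fun s => ψ (s, x)) t)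
          - ρ t x * ∑ i : Fin 3, ∑ j : Fin 3,
              u t x i * u t x j * pd j (fun y => ψ (t, y)) x i
          + ε⁻¹ * ρ t x * (u t x 0 * ψ (t, x) 1 - u t x 1 * ψ (t, x) 0)))
      + (∫ t in Ioi (0 : ℝ), ∫ x in slab ℓ,
          ∑ j : Fin 3, inner ℝ (Du t x j) (pd j (fun y => ψ (t, y)) x))
      + 2 * α * (∫ t in Ioi (0 : ℝ), ∫ y : Plane,
          (inner ℝ (γp t y) (ψ (t, (y, ℓ))) + inner ℝ (γm t y) (ψ (t, (y, -ℓ)))))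
      = ∫ x in slab ℓ, inner ℝ (m x) (ψ (0, x))

/-- The energy inequality. -/
def EnergyInequality (ℓ α : ℝ) (ρin : Space3 → ℝ) (m : Space3 → Vec3) (ρ : ℝ → Space3 → ℝ)
    (u : ℝ → Space3 → Vec3) (Du : ℝ → Space3 → Fin 3 → Vec3) (γp γm : ℝ → Plane → Vec3) : Prop :=
  ∀ᵐ t ∂(volume.restrict (Ioi (0 : ℝ))),
    (1 / 2) * (∫ x in slab ℓ, ρ t x * ‖u t x‖ ^ 2)
      + (∫ τ in Ioo 0 t, ∫ x in slab ℓ, ∑ j : Fin 3, ‖Du τ x j‖ ^ 2)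
      + 2 * α * (∫ τ in Ioo 0 t, ∫ y : Plane, (‖γp τ y‖ ^ 2 + ‖γm τ y‖ ^ 2))
      ≤ ∫ x in slab ℓ, ‖m x‖ ^ 2 / ρin x

/-- `(ρ, u)` is a global in time finite energy weak solution on `[0,∞[ × Ω`, related to the initial
datum `(ρ, ρ u)|_{t=0} = (ρin, m)`. The gradient and the traces of `u` are unique up to null
sets. -/
def IsFiniteEnergyWeakSolution (ε ℓ α : ℝ) (ρin : Space3 → ℝ) (m : Space3 → Vec3)
    (ρ : ℝ → Space3 → ℝ) (u : ℝ → Space3 → Vec3) : Prop :=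
  (∀ T : ℝ, 0 < T → MemLp (fun q : ℝ × Space3 => ρ q.1 q.2) ⊤ (cylMeasure ℓ T) ∧
    ∀ᵐ q ∂(cylMeasure ℓ T), 0 ≤ ρ q.1 q.2) ∧
  SolvesMass ℓ ρin ρ u ∧
  ∃ (Du : ℝ → Space3 → Fin 3 → Vec3) (γp γm : ℝ → Plane → Vec3),
    IsVelocity ℓ u Du γp γm ∧
    SolvesMomentum ε ℓ α m ρ u Du γp γm ∧
    EnergyInequality ℓ α ρin m ρ u Du γp γm

/-- The initial density `ρ_ε^in(x) = ρ_0^in(x_h) + ε r_ε^in(x)`. -/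
def initialDensity (ρ0 : Plane → ℝ) (rin : ℝ → Space3 → ℝ) (ε : ℝ) (x : Space3) : ℝ :=
  ρ0 x.1 + ε * rin ε x

/-- The `H²(ℝ²)` norm of a smooth compactly supported function. -/
def normH2 (φ : Plane → ℝ) : ℝ :=
  √(∑ k ∈ Finset.range 3, ∫ y : Plane, ‖iteratedFDeriv ℝ k φ y‖ ^ 2)

/-- `∫_{Ω ∩ {ρ ≤ δ}} 1/ρ`, with the convention `1/0 = ∞`. -/
def vacuumIntegral (ℓ : ℝ) (ρ : Space3 → ℝ) (δ : ℝ) : ℝ≥0∞ :=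
  ∫⁻ x in slab ℓ, {x | ρ x ≤ δ}.indicator (fun x => (ENNReal.ofReal (ρ x))⁻¹) x

/-- The standing assumptions on the initial data `(ρ_ε^in, m_ε^in)`, for `ε` in the parameter
set `E`. -/
structure InitialDataAssumptions (E : Set ℝ) (ℓ : ℝ → ℝ) (ρ0 : Plane → ℝ) (rin : ℝ → Space3 → ℝ)
    (m : ℝ → Space3 → Vec3) : Prop where
  /-- `ρ_0^in ∈ C²_b(ℝ²)`. -/
  profile_C2 : ContDiff ℝ 2 ρ0
  profile_bounded : ∃ C : ℝ, ∀ k ≤ 2, ∀ y : Plane, ‖iteratedFDeriv ℝ k ρ0 y‖ ≤ C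
  /-- `0 ≤ ρ_0^in ≤ ρ^*` and `0 ≤ ρ_ε^in ≤ 2 ρ^*`. -/
  density_bounds : ∃ ρs : ℝ, 0 < ρs ∧ (∀ y, 0 ≤ ρ0 y ∧ ρ0 y ≤ ρs) ∧
    ∀ ε ∈ E, ∀ᵐ x ∂(slabMeasure (ℓ ε)),
      0 ≤ initialDensity ρ0 rin ε x ∧ initialDensity ρ0 rin ε x ≤ 2 * ρs
  density_memLp : ∀ ε ∈ E, MemLp (initialDensity ρ0 rin ε) ⊤ (slabMeasure (ℓ ε))
  density_nonvacuum : ∀ ε ∈ E, ∃ δ : ℝ, 0 < δ ∧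
    vacuumIntegral (ℓ ε) (initialDensity ρ0 rin ε) δ < ⊤
  /-- The averages of `r_ε^in` are bounded in `L^∞(ℝ²)` and in `H^{-2}(ℝ²)`, the dual of
  `H²(ℝ²)`. -/
  perturbation_Linfty : ∃ C : ℝ, ∀ ε ∈ E, ∀ᵐ y : Plane, |vAvg (ℓ ε) (rin ε) y| ≤ C
  perturbation_Hneg2 : ∃ C : ℝ, ∀ ε ∈ E, ∀ φ : Plane → ℝ, IsTest φ →
    |∫ y : Plane, vAvg (ℓ ε) (rin ε) y * φ y| ≤ C * normH2 φ
  momentum_memLp : ∀ ε ∈ E, MemLp (m ε) 2 (slabMeasure (ℓ ε))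
  momentum_vacuum : ∀ ε ∈ E, ∀ᵐ x ∂(slabMeasure (ℓ ε)),
    initialDensity ρ0 rin ε x = 0 → m ε x = 0
  momentum_energy : ∀ ε ∈ E,
    Integrable (fun x => ‖m ε x‖ ^ 2 / initialDensity ρ0 rin ε x) (slabMeasure (ℓ ε))
  /-- The averages of `m_ε^in` are bounded in `L²(ℝ²)`. -/
  momentum_avg : ∃ C : ℝ, ∀ ε ∈ E, MemLp (vAvg (ℓ ε) (m ε)) 2 volume ∧
    ∫ y : Plane, ‖vAvg (ℓ ε) (m ε) y‖ ^ 2 ≤ C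
  /-- Uniform bound on the averaged initial energies. -/
  energy_unif : ∃ C : ℝ, ∀ ε ∈ E,
    (2 * ℓ ε)⁻¹ * ∫ x in slab (ℓ ε), ‖m ε x‖ ^ 2 / initialDensity ρ0 rin ε x ≤ C
  nonvacuum_unif : ∃ δ : ℝ, 0 < δ ∧ ∃ C : ℝ, ∀ ε ∈ E,
    (ENNReal.ofReal (2 * ℓ ε))⁻¹ * vacuumIntegral (ℓ ε) (initialDensity ρ0 rin ε) δ
      ≤ ENNReal.ofReal C
  /-- Non-degeneracy of a non-constant profile. -/
  nondegenerate : (¬ ∃ c : ℝ, ∀ y, ρ0 y = c) → ∀ K : Set Plane, IsCompact K →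
    Tendsto (fun δ : ℝ => volume {y ∈ K | ‖gradient ρ0 y‖ ≤ δ}) (𝓝[>] 0) (𝓝 0)

/-- `f_ε ⇀ g` weakly-* in `L^∞([0,T] × ℝ²)` as `ε → 0` in `E`, for a time independent `g`. -/
def TendstoWeakStar (E : Set ℝ) (T : ℝ) (f : ℝ → ℝ → Plane → ℝ) (g : Plane → ℝ) : Prop :=
  (∀ ε ∈ E, MemLp (fun q : ℝ × Plane => f ε q.1 q.2) ⊤ (planeCylMeasure T)) ∧
  ∀ φ : ℝ × Plane → ℝ, Integrable φ (planeCylMeasure T) →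
    Tendsto (fun ε => ∫ q, f ε q.1 q.2 * φ q ∂(planeCylMeasure T)) (𝓝[E] 0)
      (𝓝 (∫ q, g q.2 * φ q ∂(planeCylMeasure T)))

/-- `F_ε → g` in `C⁰([0,T]; L^p_w(K))` as `ε → 0` in `E`, for a time independent `g`: each `F_ε` is
weakly continuous in time with values in `L^p(K)`, and the convergence of the pairings with any
element of the dual `L^q(K)` is uniform in `t ∈ [0,T]`. -/
def TendstoCWeak (E : Set ℝ) (T : ℝ) (K : Set Plane) (p : ℝ≥0∞) (F : ℝ → ℝ → Plane → ℝ)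
    (g : Plane → ℝ) : Prop :=
  (∀ ε ∈ E, ∀ t ∈ Icc 0 T, MemLp (F ε t) p (volume.restrict K)) ∧
  ∀ q : ℝ≥0∞, p.HolderConjugate q → ∀ φ : Plane → ℝ, MemLp φ q (volume.restrict K) →
    (∀ ε ∈ E, ContinuousOn (fun t => ∫ y in K, F ε t y * φ y) (Icc 0 T)) ∧
    TendstoUniformlyOn (fun ε t => ∫ y in K, F ε t y * φ y) (fun _ => ∫ y in K, g y * φ y)
      (𝓝[E] 0) (Icc 0 T)

end

/-
Two mechanisms combine. Since the slab is thin, `∫ |u|²` over it is at most `4ℓ` times the integral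
of the squared trace plus `8ℓ²` times `∫ |∂₃u|²`. The energy inequality bounds the dissipation by
`2ℓC` and the squared traces by `ℓC/α`, so the vertical mean of `|u|²` is `O(ℓ/α + ℓ²)`: the
averaged velocity tends to `0`.

Testing the renormalised mass equation with functions of `β(ρ)` vanishing on `[0, M]` propagates
`0 ≤ ρ ≤ M` from the initial datum; a cutoff in the plane has gradients bounded in `L²`, which is
enough because `u` is square integrable. The flux in the averaged mass equation is then controlled
by the vertical mean of `|u|²`, so that the averaged density stays uniformly close, against test
functions, to its initial value. As `0 ≤ ρ ≤ M`, density of test functions in `L¹` extends this to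
all integrable functions.
-/

section TestFunctions

variable {X : Type*} [NormedAddCommGroup X] [NormedSpace ℝ X] [MeasurableSpace X] [BorelSpace X]

theorem IsTest.memLp {μ : Measure X} [IsFiniteMeasureOnCompacts μ] {φ : X → ℝ} (h : IsTest φ)
    (p : ℝ≥0∞) : MemLp φ p μ :=
  h.1.continuous.memLp_of_hasCompactSupport h.2

theorem IsTest.integrable {μ : Measure X} [IsFiniteMeasureOnCompacts μ] {φ : X → ℝ}
    (h : IsTest φ) : Integrable φ μ :=
  h.1.continuous.integrable_of_hasCompactSupport h.2

variable [FiniteDimensional ℝ X] {μ : Measure X} [IsFiniteMeasureOnCompacts μ]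

theorem exists_isTest_integral_abs_sub_le {f : X → ℝ} (hf : Integrable f μ) {δ : ℝ}
    (hδ : 0 < δ) : ∃ ψ : X → ℝ, IsTest ψ ∧ ∫ x, |f x - ψ x| ∂μ ≤ δ := by
  obtain ⟨ψ, hψc, hψs, hψ⟩ :=
    (memLp_one_iff_integrable.2 hf).exist_eLpNorm_sub_le ENNReal.one_ne_top le_rfl hδ
  refine ⟨ψ, ⟨hψs, hψc⟩, ?_⟩
  have hint : Integrable (f - ψ) μ := hf.sub (IsTest.integrable ⟨hψs, hψc⟩)
  rw [eLpNorm_one_eq_lintegral_enorm, ← ofReal_integral_norm_eq_lintegral_enorm hint] at hψ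
  exact (ENNReal.ofReal_le_ofReal_iff hδ.le).1 hψ

theorem exists_seq_isTest_separating [SigmaFinite μ] {p q : ℝ≥0∞} [hpq : p.HolderConjugate q]
    (hp : p ≠ ⊤) {F : Type*} [NormedAddCommGroup F] [NormedSpace ℝ F] [CompleteSpace F] :
    ∃ ψ : ℕ → X → ℝ, (∀ n, IsTest (ψ n)) ∧
      ∀ f : X → F, MemLp f q μ → (∀ n, ∫ x, ψ n x • f x ∂μ = 0) → f =ᵐ[μ] 0 := by
  have : Fact (1 ≤ p) := ⟨ENNReal.HolderConjugate.one_le p q⟩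
  have : Fact (1 ≤ q) := ⟨ENNReal.HolderConjugate.one_le q p⟩
  have : Fact (p ≠ ⊤) := ⟨hp⟩
  obtain ⟨D, hD, hDc, hDd⟩ :=
    (Lp.dense_hasCompactSupport_contDiff (F := ℝ) (μ := μ) hp).exists_countable_dense_subset
  obtain ⟨e, rfl⟩ := hDc.exists_eq_range hDd.nonempty
  choose ψ hψe hψc hψs using fun n => hD (mem_range_self n)
  refine ⟨ψ, fun n => ⟨hψs n, hψc n⟩, fun f hf hψf => ?_⟩
  set pairing : Lp ℝ p μ →L[ℝ] F :=
    ((ContinuousLinearMap.lsmul ℝ ℝ).lpPairing μ p q).flip hf.toLp with hpairing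
  have pairing_apply : ∀ g, pairing g = ∫ x, g x • f x ∂μ := fun g => by
    rw [hpairing, ContinuousLinearMap.flip_apply, ContinuousLinearMap.lpPairing_eq_integral]
    refine integral_congr_ae ?_
    filter_upwards [hf.coeFn_toLp] with x hx
    rw [hx, ContinuousLinearMap.lsmul_apply]
  have pairing_zero : ∀ g, pairing g = 0 := by
    refine congrFun (Continuous.ext_on hDd pairing.continuous continuous_const ?_)
    rintro _ ⟨n, rfl⟩
    rw [pairing_apply, ← hψf n]
    refine integral_congr_ae ?_
    filter_upwards [hψe n] with x hx
    rw [hx]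
  have hf_loc : ∀ s, MeasurableSet s → μ s < ⊤ → IntegrableOn f s μ := fun s _ hs => by
    have : IsFiniteMeasure (μ.restrict s) := isFiniteMeasure_restrict.2 hs.ne
    exact (hf.restrict s).integrable Fact.out
  refine ae_eq_zero_of_forall_setIntegral_eq_of_sigmaFinite hf_loc fun s hs hμs => ?_
  rw [← pairing_zero (indicatorConstLp p hs hμs.ne (1 : ℝ)), pairing_apply,
    ← integral_indicator hs]
  refine integral_congr_ae ?_
  filter_upwards [indicatorConstLp_coeFn (p := p) (hs := hs) (hμs := hμs.ne) (c := (1 : ℝ))]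
    with x hx
  rw [hx, ← indicator_smul_apply_left]
  simp

end TestFunctions

section Primitive

variable {F : Type*} [NormedAddCommGroup F] [NormedSpace ℝ F] {a b : ℝ}

theorem IsTest.deriv {φ : ℝ → F} (h : IsTest φ) : IsTest (deriv φ) :=
  ⟨(contDiff_infty_iff_deriv.1 h.1).2, h.2.deriv⟩

theorem continuousOn_primitive_Icc {H : ℝ → F} (hH : IntegrableOn H (Ioo a b)) :
    ContinuousOn (fun t => ∫ s in Ioc a t, H s) (Icc a b) :=
  intervalIntegral.continuousOn_primitive ((integrableOn_Icc_iff_integrableOn_Ioo).2 hH)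

theorem exists_isTest_deriv_eqOn {g : ℝ → ℝ} (hg : IsTest g) (hgb : tsupport g ⊆ Iio b) (a : ℝ) :
    ∃ θ : ℝ → ℝ, IsTest θ ∧ tsupport θ ⊆ Iio b ∧ EqOn (deriv θ) g (Ioi a) := by
  obtain ⟨c, hcb, hc⟩ : ∃ c < b, tsupport g ⊆ Iic c := by
    rcases (tsupport g).eq_empty_or_nonempty with h | h
    · exact ⟨b - 1, by linarith, by simp [h]⟩
    · obtain ⟨c, hc⟩ := hg.2.isCompact.exists_isGreatest h
      exact ⟨c, hgb hc.1, hc.2⟩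
  let G : ℝ → ℝ := fun t => ∫ s in c..t, g s
  have hGd : ∀ t, HasDerivAt G (g t) t := fun t => hg.1.continuous.integral_hasStrictDerivAt c t
    |>.hasDerivAt
  have hG : ContDiff ℝ ∞ G := contDiff_infty_iff_deriv.2
    ⟨fun t => (hGd t).differentiableAt, (funext fun t => (hGd t).deriv : _root_.deriv G = g) ▸ hg.1⟩
  have hGc : ∀ t, c < t → G t = 0 := fun t hct =>
    intervalIntegral.integral_zero_ae (.of_forall fun s hs => image_eq_zero_of_notMem_tsupport
      fun hm => (hc hm).not_gt (uIoc_of_le hct.le ▸ hs).1)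
  let θ : ℝ → ℝ := fun t => Real.smoothTransition (t - a + 2) * G t
  have hθ_supp : tsupport θ ⊆ Icc (a - 2) c := by
    refine closure_minimal (fun t ht => ?_) isClosed_Icc
    by_contra hout
    refine ht ?_
    rcases not_and_or.1 hout with h | h
    · simp only [θ, Real.smoothTransition.zero_of_nonpos (by linarith : t - a + 2 ≤ 0), zero_mul]
    · simp only [θ, hGc t (not_le.1 h), mul_zero]
  have hθG : EqOn θ G (Ioi a) := fun t ht => by
    have : a < t := ht
    simp only [θ, Real.smoothTransition.one_of_one_le (by linarith : 1 ≤ t - a + 2), one_mul]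
  refine ⟨θ, ⟨(Real.smoothTransition.contDiff.comp (by fun_prop)).mul hG,
    isCompact_Icc.of_isClosed_subset (isClosed_tsupport θ) hθ_supp⟩,
    hθ_supp.trans fun t ht => ht.2.trans_lt hcb, fun t ht => ?_⟩
  rw [(hθG.eventuallyEq_of_mem (Ioi_mem_nhds ht)).deriv_eq, (hGd t).deriv]

theorem IsTest.integral_deriv_Ioo {θ : ℝ → ℝ} (hθ : IsTest θ) (hab : a ≤ b) (hθb : θ b = 0) :
    ∫ t in Ioo a b, _root_.deriv θ t = -θ a := by
  rw [← integral_Ioc_eq_integral_Ioo, ← intervalIntegral.integral_of_le hab,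
    intervalIntegral.integral_deriv_eq_sub (fun t _ => hθ.1.differentiable (by simp) t)
      (hθ.deriv.1.continuous.intervalIntegrable _ _), hθb, zero_sub]

theorem integral_deriv_smul_primitive [CompleteSpace F] {θ : ℝ → ℝ} (hθ : IsTest θ)
    (hθb : θ b = 0) {H : ℝ → F} (hH : IntegrableOn H (Ioo a b)) :
    ∫ t in Ioo a b, deriv θ t • ∫ s in Ioc a t, H s = -∫ t in Ioo a b, θ t • H t := by
  set S : Set (ℝ × ℝ) := {q | q.2 ≤ q.1}
  have hS_meas : MeasurableSet S := measurableSet_le measurable_snd measurable_fst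
  have hint : Integrable (fun q : ℝ × ℝ => deriv θ q.1 • H q.2)
      ((volume.restrict (Ioo a b)).prod (volume.restrict (Ioo a b))) :=
    hθ.deriv.integrable.smul_prod hH
  have primitive_eq : ∀ t ∈ Ioo a b, deriv θ t • ∫ s in Ioc a t, H s
      = ∫ s in Ioo a b, S.indicator (fun q => deriv θ q.1 • H q.2) (t, s) := fun t ht => by
    have : (fun s => S.indicator (fun q => deriv θ q.1 • H q.2) (t, s))
        = (Iic t).indicator fun s => deriv θ t • H s := rfl
    rw [this, setIntegral_indicator measurableSet_Iic, integral_smul]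
    congr 3
    ext s
    grind
  have theta_eq : ∀ s ∈ Ioo a b, -(θ s • H s)
      = ∫ t in Ioo a b, S.indicator (fun q => deriv θ q.1 • H q.2) (t, s) := fun s hs => by
    have : (fun t => S.indicator (fun q => deriv θ q.1 • H q.2) (t, s))
        = (Ici s).indicator fun t => deriv θ t • H s := rfl
    have hset : Ioo a b ∩ Ici s = Ico s b := by ext t; grind
    rw [this, setIntegral_indicator measurableSet_Ici, integral_smul_const, hset,
      integral_Ico_eq_integral_Ioo, hθ.integral_deriv_Ioo hs.2.le hθb, neg_smul]
  rw [← integral_neg, setIntegral_congr_fun measurableSet_Ioo primitive_eq,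
    setIntegral_congr_fun measurableSet_Ioo theta_eq]
  exact integral_integral_swap (hint.indicator hS_meas)

theorem ae_eq_add_primitive [CompleteSpace F] (hab : a < b) {A H : ℝ → F} {A₀ : F}
    (hA : IntegrableOn A (Ioo a b)) (hH : IntegrableOn H (Ioo a b))
    (h : ∀ θ : ℝ → ℝ, IsTest θ → tsupport θ ⊆ Iio b →
      ∫ t in Ioo a b, (deriv θ t • A t + θ t • H t) = -(θ a • A₀)) :
    ∀ᵐ t ∂volume.restrict (Ioo a b), A t = A₀ + ∫ s in Ioc a t, H s := by
  set P : ℝ → F := fun t => ∫ s in Ioc a t, H s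
  have hP : IntegrableOn P (Ioo a b) :=
    ((continuousOn_primitive_Icc hH).integrableOn_Icc).mono_set Ioo_subset_Icc_self
  have hA₀ : IntegrableOn (fun _ => A₀) (Ioo a b) := integrableOn_const (by simp)
  have hdiff : IntegrableOn (fun t => A t - A₀ - P t) (Ioo a b) := (hA.sub hA₀).sub hP
  have key := isOpen_Ioo.ae_eq_zero_of_integral_contDiff_smul_eq_zero
    hdiff.locallyIntegrableOn fun g hgs hgc hg => ?_
  · refine (ae_restrict_iff' measurableSet_Ioo).2 (key.mono fun t ht hmem => ?_)
    rw [← sub_eq_zero, ← sub_sub, ht hmem]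
  obtain ⟨θ, hθ, hθb, hθg⟩ := exists_isTest_deriv_eqOn ⟨hgs, hgc⟩ (hg.trans fun t ht => ht.2) a
  have hθb0 : θ b = 0 := image_eq_zero_of_notMem_tsupport fun hm => lt_irrefl b (hθb hm)
  have smul_int : ∀ {k : ℝ → ℝ} {f : ℝ → F}, IsTest k → IntegrableOn f (Ioo a b) →
      IntegrableOn (fun t => k t • f t) (Ioo a b) := fun hk hf =>
    hf.smul_of_top_right (hk.memLp ⊤)
  have deriv_A : ∫ t in Ioo a b, deriv θ t • A t = -(θ a • A₀) - ∫ t in Ioo a b, θ t • H t := by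
    rw [← h θ hθ hθb, integral_add (smul_int hθ.deriv hA) (smul_int hθ hH), add_sub_cancel_right]
  have deriv_A₀ : ∫ t in Ioo a b, deriv θ t • A₀ = -(θ a • A₀) := by
    rw [integral_smul_const, hθ.integral_deriv_Ioo hab.le hθb0, neg_smul]
  have sub_int : IntegrableOn (fun t => deriv θ t • A t - deriv θ t • A₀) (Ioo a b) :=
    (smul_int hθ.deriv hA).sub (smul_int hθ.deriv hA₀)
  calc ∫ t, g t • (A t - A₀ - P t)
      = ∫ t in Ioo a b, deriv θ t • (A t - A₀ - P t) := by
        rw [← setIntegral_eq_integral_of_forall_compl_eq_zero (s := Ioo a b)]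
        · exact setIntegral_congr_fun measurableSet_Ioo fun t ht => by rw [hθg ht.1]
        · exact fun t ht => by
            rw [image_eq_zero_of_notMem_tsupport fun hm => ht (hg hm), zero_smul]
    _ = 0 := by
        simp only [smul_sub]
        rw [integral_sub sub_int (smul_int hθ.deriv hP),
          integral_sub (smul_int hθ.deriv hA) (smul_int hθ.deriv hA₀), deriv_A, deriv_A₀,
          integral_deriv_smul_primitive hθ hθb0 hH]
        abel

end Primitive

section Between

variable {X : Type*} [MeasurableSpace X] {μ : Measure X} {M : ℝ} {f g : X → ℝ}

/-- `f` is a measurable function with values in `[0, M]`, up to a `μ`-null set: the order interval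
of `L^∞(μ)` in which densities and their vertical averages live. -/
def IsBetween (M : ℝ) (f : X → ℝ) (μ : Measure X) : Prop :=
  AEStronglyMeasurable f μ ∧ ∀ᵐ x ∂μ, 0 ≤ f x ∧ f x ≤ M

theorem IsBetween.ae_abs_le (hf : IsBetween M f μ) : ∀ᵐ x ∂μ, |f x| ≤ M :=
  hf.2.mono fun _ hx => (abs_of_nonneg hx.1).trans_le hx.2

theorem IsBetween.congr (hf : IsBetween M f μ) (h : f =ᵐ[μ] g) : IsBetween M g μ :=
  ⟨hf.1.congr h, by filter_upwards [hf.2, h] with x hx h using h ▸ hx⟩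

theorem IsBetween.nonneg [NeZero μ] (hf : IsBetween M f μ) : 0 ≤ M :=
  let ⟨_, h⟩ := hf.2.exists
  h.1.trans h.2

theorem IsBetween.memLp_top (hf : IsBetween M f μ) : MemLp f ⊤ μ :=
  memLp_top_of_bound hf.1 M hf.ae_abs_le

theorem IsBetween.integrable_mul (hf : IsBetween M f μ) (hg : Integrable g μ) :
    Integrable (fun x => f x * g x) μ :=
  hg.bdd_mul hf.1 hf.ae_abs_le

theorem IsBetween.abs_integral_mul_le (hf : IsBetween M f μ) (hg : Integrable g μ) :
    |∫ x, f x * g x ∂μ| ≤ M * ∫ x, |g x| ∂μ := by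
  rw [← integral_const_mul]
  refine norm_integral_le_of_norm_le (f := fun x => f x * g x) (hg.abs.const_mul M) ?_
  filter_upwards [hf.ae_abs_le] with x hx
  rw [norm_mul]
  exact mul_le_mul_of_nonneg_right hx (abs_nonneg _)

theorem IsBetween.abs_integral_mul_sub_le (hf : IsBetween M f μ) {g' : X → ℝ}
    (hg : Integrable g μ) (hg' : Integrable g' μ) :
    |(∫ x, f x * g x ∂μ) - ∫ x, f x * g' x ∂μ| ≤ M * ∫ x, |g x - g' x| ∂μ := by
  rw [← integral_sub (hf.integrable_mul hg) (hf.integrable_mul hg')]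
  simpa only [mul_sub, Pi.sub_apply] using hf.abs_integral_mul_le (hg.sub hg')

theorem IsBetween.ae_prodMk_left {Y : Type*} [MeasurableSpace Y] {ν : Measure Y} [SFinite μ]
    {f : Y × X → ℝ} (hf : IsBetween M f (ν.prod μ)) : ∀ᵐ t ∂ν, IsBetween M (fun x => f (t, x)) μ :=
  hf.1.prodMk_left.and (Measure.ae_ae_of_ae_prod hf.2)

theorem isBetween_rnDeriv [SigmaFinite μ] {ν : Measure X} (hM : 0 ≤ M)
    (h : ν ≤ ENNReal.ofReal M • μ) : IsBetween M (fun x => (ν.rnDeriv μ x).toReal) μ := by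
  refine ⟨(ν.measurable_rnDeriv μ).ennreal_toReal.aestronglyMeasurable, ?_⟩
  have hle : ν.rnDeriv μ ≤ᵐ[μ] fun _ => ENNReal.ofReal M :=
    ae_le_of_forall_setLIntegral_le_of_sigmaFinite (ν.measurable_rnDeriv μ) fun s _ _ =>
      calc ∫⁻ x in s, ν.rnDeriv μ x ∂μ ≤ ν s := Measure.setLIntegral_rnDeriv_le s
        _ ≤ (ENNReal.ofReal M • μ) s := h s
        _ = ∫⁻ _ in s, ENNReal.ofReal M ∂μ := by simp
  filter_upwards [hle] with x hx
  exact ⟨ENNReal.toReal_nonneg, ENNReal.toReal_le_of_le_ofReal hM hx⟩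

end Between

section Duality

open scoped CompactlySupported

theorem exists_isBetween_compactlySupported {X : Type*} [MetricSpace X] [ProperSpace X]
    [MeasurableSpace X] [BorelSpace X] {μ : Measure X} [IsFiniteMeasureOnCompacts μ] {M : ℝ}
    (hM : 0 ≤ M) (Λ : C_c(X, ℝ) →ₗ[ℝ] ℝ) (hpos : ∀ f, 0 ≤ f → 0 ≤ Λ f)
    (hle : ∀ f, 0 ≤ f → Λ f ≤ M * ∫ x, f x ∂μ) :
    ∃ h : X → ℝ, IsBetween M h μ ∧ ∀ f, Λ f = ∫ x, h x * f x ∂μ := by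
  let I : C_c(X, ℝ) →ₗ[ℝ] ℝ :=
    (CompactlySupportedContinuousMap.integralPositiveLinearMap μ).toLinearMap
  have hI : ∀ f, I f = ∫ x, f x ∂μ :=
    CompactlySupportedContinuousMap.integralPositiveLinearMap_apply μ
  let Λ₁ := PositiveLinearMap.mk₀ Λ hpos
  let Λ₂ := PositiveLinearMap.mk₀ (M • I - Λ) fun f hf => by
    simpa [hI] using hle f hf
  have hsum : RealRMK.rieszMeasure Λ₁ + RealRMK.rieszMeasure Λ₂ = ENNReal.ofReal M • μ := by
    have : IsFiniteMeasureOnCompacts (RealRMK.rieszMeasure Λ₁ + RealRMK.rieszMeasure Λ₂) :=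
      ⟨fun K hK => by simp [hK.measure_lt_top]⟩
    have : IsFiniteMeasureOnCompacts (ENNReal.ofReal M • μ) := .smul μ ENNReal.ofReal_ne_top
    refine Measure.ext_of_integral_eq_on_compactlySupported fun f => ?_
    rw [integral_add_measure f.integrable f.integrable, RealRMK.integral_rieszMeasure,
      RealRMK.integral_rieszMeasure, integral_smul_measure, ENNReal.toReal_ofReal hM, ← hI]
    exact add_sub_cancel (Λ f) (M * I f)
  have hν : RealRMK.rieszMeasure Λ₁ ≤ ENNReal.ofReal M • μ := hsum ▸ Measure.le_add_right le_rfl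
  refine ⟨_, isBetween_rnDeriv hM hν, fun f => ?_⟩
  rw [integral_toReal_rnDeriv_mul (Measure.absolutelyContinuous_of_le_smul hν),
    RealRMK.integral_rieszMeasure]
  rfl

theorem exists_isBetween_integral_eq {X : Type*} [NormedAddCommGroup X] [NormedSpace ℝ X]
    [FiniteDimensional ℝ X] [MeasurableSpace X] [BorelSpace X] {μ : Measure X}
    [IsFiniteMeasureOnCompacts μ] {M : ℝ} (hM : 0 ≤ M) {Λ : (X → ℝ) → ℝ}
    (hadd : ∀ f g, Integrable f μ → Integrable g μ → Λ (f + g) = Λ f + Λ g)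
    (hsmul : ∀ (c : ℝ) f, Integrable f μ → Λ (c • f) = c * Λ f)
    (hpos : ∀ f, Integrable f μ → 0 ≤ f → 0 ≤ Λ f)
    (hbound : ∀ f, Integrable f μ → |Λ f| ≤ M * ∫ x, |f x| ∂μ) :
    ∃ h : X → ℝ, IsBetween M h μ ∧ ∀ f, Integrable f μ → Λ f = ∫ x, h x * f x ∂μ := by
  have : ProperSpace X := FiniteDimensional.proper ℝ X
  let Λc : C_c(X, ℝ) →ₗ[ℝ] ℝ :=
    { toFun := fun f => Λ f
      map_add' := fun f g => hadd f g f.integrable g.integrable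
      map_smul' := fun c f => hsmul c f f.integrable }
  obtain ⟨h, hh, hΛh⟩ := exists_isBetween_compactlySupported (μ := μ) hM Λc
    (fun f hf => hpos f f.integrable hf) fun f hf => by
      refine (le_abs_self _).trans ((hbound f f.integrable).trans_eq ?_)
      simp only [fun x => abs_of_nonneg (hf x)]
  refine ⟨h, hh, fun f hf => eq_of_forall_dist_le fun δ hδ => ?_⟩
  obtain ⟨ψ, hψ, hfψ⟩ := exists_isTest_integral_abs_sub_le hf
    (by positivity : 0 < δ / (2 * (M + 1)))
  have hΛψ : Λ ψ = ∫ x, h x * ψ x ∂μ := hΛh ⟨⟨ψ, hψ.1.continuous⟩, hψ.2⟩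
  have hΛsub : Λ f - Λ ψ = Λ (f - ψ) := by
    rw [sub_eq_iff_eq_add, ← hadd _ _ (hf.sub hψ.integrable) hψ.integrable, sub_add_cancel]
  calc |Λ f - ∫ x, h x * f x ∂μ|
      ≤ |Λ f - Λ ψ| + |(∫ x, h x * f x ∂μ) - ∫ x, h x * ψ x ∂μ| := by
        rw [hΛψ, abs_sub_comm (∫ x, h x * f x ∂μ)]; exact abs_sub_le _ _ _
    _ ≤ M * (∫ x, |f x - ψ x| ∂μ) + M * ∫ x, |f x - ψ x| ∂μ :=
        add_le_add (hΛsub ▸ hbound _ (hf.sub hψ.integrable))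
          (hh.abs_integral_mul_sub_le hf hψ.integrable)
    _ ≤ (M + 1) * (δ / (2 * (M + 1))) + (M + 1) * (δ / (2 * (M + 1))) := by
        gcongr <;> linarith
    _ = δ := by field_simp; ring

end Duality

section WeaklyContinuous

variable {Y : Type*} [TopologicalSpace Y] [MeasurableSpace Y] {ν : Measure Y} [ν.IsOpenPosMeasure]
  {S : Set Y}

theorem le_on_of_ae_le {A B : Y → ℝ} (h : A ≤ᵐ[ν.restrict S] B) (hA : ContinuousOn A S)
    (hB : ContinuousOn B S) (hS : S ⊆ closure (interior S)) : ∀ t ∈ S, A t ≤ B t := fun _ ht =>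
  sup_eq_right.1 (Measure.eqOn_of_ae_eq (h.mono fun _ hs => sup_eq_right.2 hs) (hA.sup hB) hB hS ht)

theorem exists_continuousOn_ae_eq (hS_meas : MeasurableSet S)
    (hS : S ⊆ closure (interior S)) {a : Y → ℝ}
    (ha : ∀ δ > 0, ∃ A : Y → ℝ, ContinuousOn A S ∧ ∀ᵐ t ∂ν.restrict S, |a t - A t| ≤ δ) :
    ∃ A : Y → ℝ, ContinuousOn A S ∧ a =ᵐ[ν.restrict S] A := by
  choose A hAc hA using fun n : ℕ => ha (1 / ((n : ℝ) + 1)) Nat.one_div_pos_of_nat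
  have hδ := tendsto_one_div_add_atTop_nhds_zero_nat (𝕜 := ℝ)
  have hdist : ∀ m n, ∀ t ∈ S, |A m t - A n t| ≤ 1 / (m + 1) + 1 / (n + 1) := fun m n =>
    le_on_of_ae_le (ν := ν) (by
      filter_upwards [hA m, hA n] with t hm hn
      exact (abs_sub_le _ (a t) _).trans (add_le_add (abs_sub_comm _ (a t) ▸ hm) hn))
      ((hAc m).sub (hAc n)).abs continuousOn_const hS
  have hcauchy : UniformCauchySeqOn A atTop S := by
    refine Metric.uniformCauchySeqOn_iff.2 fun ε hε => ?_
    obtain ⟨N, hN⟩ := eventually_atTop.1 (hδ.eventually_lt_const (half_pos hε))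
    exact ⟨N, fun m hm n hn t ht => (hdist m n t ht).trans_lt (by linarith [hN m hm, hN n hn])⟩
  have hlim : ∀ t ∈ S, ∃ b, Tendsto (fun n => A n t) atTop (𝓝 b) := fun t ht =>
    cauchySeq_tendsto_of_complete (hcauchy.cauchySeq ht)
  choose! B hB using hlim
  have hunif : TendstoUniformlyOn A B atTop S := hcauchy.tendstoUniformlyOn_of_tendsto hB
  refine ⟨B, hunif.continuousOn (.of_forall hAc), ?_⟩
  filter_upwards [ae_all_iff.2 hA, ae_restrict_mem hS_meas] with t hat ht
  exact tendsto_nhds_unique (tendsto_iff_dist_tendsto_zero.2 (squeeze_zero (fun _ => dist_nonneg)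
    (fun n => (dist_comm _ _).trans_le (hat n)) hδ)) (hB t ht)

variable {X : Type*} [NormedAddCommGroup X] [NormedSpace ℝ X] [FiniteDimensional ℝ X]
  [MeasurableSpace X] [BorelSpace X] {μ : Measure X} [IsFiniteMeasureOnCompacts μ] {M : ℝ}
  {f : Y → X → ℝ}

theorem exists_continuousOn_pairing (hM : 0 ≤ M) (hS_meas : MeasurableSet S)
    (hS : S ⊆ closure (interior S))
    (hf : ∀ᵐ t ∂ν.restrict S, IsBetween M (f t) μ)
    (hpair : ∀ ψ : X → ℝ, IsTest ψ → ∃ A : Y → ℝ, ContinuousOn A S ∧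
      ∀ᵐ t ∂ν.restrict S, ∫ x, f t x * ψ x ∂μ = A t)
    {g : X → ℝ} (hg : Integrable g μ) :
    ∃ A : Y → ℝ, ContinuousOn A S ∧ ∀ᵐ t ∂ν.restrict S, ∫ x, f t x * g x ∂μ = A t := by
  refine exists_continuousOn_ae_eq (ν := ν) hS_meas hS fun δ hδ => ?_
  obtain ⟨ψ, hψ, hgψ⟩ := exists_isTest_integral_abs_sub_le hg
    (div_pos hδ (by positivity : 0 < M + 1))
  obtain ⟨A, hAc, hA⟩ := hpair ψ hψ
  refine ⟨A, hAc, ?_⟩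
  filter_upwards [hf, hA] with t hft hAt
  calc |(∫ x, f t x * g x ∂μ) - A t| ≤ M * ∫ x, |g x - ψ x| ∂μ :=
        hAt ▸ hft.abs_integral_mul_sub_le hg hψ.integrable
    _ ≤ (M + 1) * (δ / (M + 1)) := by gcongr; linarith
    _ = δ := by field_simp

theorem exists_isBetween_pairing_eq (hM : 0 ≤ M) (hS : S ⊆ closure (interior S))
    (hf : ∀ᵐ t ∂ν.restrict S, IsBetween M (f t) μ) {A : (X → ℝ) → Y → ℝ}
    (hAc : ∀ g, Integrable g μ → ContinuousOn (A g) S)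
    (hA : ∀ g, Integrable g μ → ∀ᵐ t ∂ν.restrict S, ∫ x, f t x * g x ∂μ = A g t)
    {t : Y} (ht : t ∈ S) :
    ∃ h : X → ℝ, IsBetween M h μ ∧ ∀ g, Integrable g μ → A g t = ∫ x, h x * g x ∂μ := by
  refine exists_isBetween_integral_eq (Λ := fun g => A g t) hM (fun g k hg hk => ?_)
    (fun c g hg => ?_) (fun g hg hg0 => ?_) fun g hg => ?_
  · refine Measure.eqOn_of_ae_eq (μ := ν) ?_ (hAc _ (hg.add hk)) ((hAc g hg).add (hAc k hk)) hS ht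
    filter_upwards [hf, hA _ (hg.add hk), hA g hg, hA k hk] with s hs hgk hgs hks
    rw [Pi.add_apply, ← hgk, ← hgs, ← hks, ← integral_add (hs.integrable_mul hg)
      (hs.integrable_mul hk)]
    simp only [Pi.add_apply, mul_add]
  · refine Measure.eqOn_of_ae_eq (μ := ν) ?_ (hAc _ (hg.smul c)) ((hAc g hg).const_mul c) hS ht
    filter_upwards [hA _ (hg.smul c), hA g hg] with s hcs hs
    rw [← hcs, ← hs, ← integral_const_mul]
    simp only [Pi.smul_apply, smul_eq_mul, mul_left_comm]
  · refine le_on_of_ae_le (ν := ν) ?_ continuousOn_const (hAc g hg) hS t ht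
    filter_upwards [hf, hA g hg] with s hs hgs
    rw [← hgs]
    exact integral_nonneg_of_ae (hs.2.mono fun x hx => mul_nonneg hx.1 (hg0 x))
  · refine le_on_of_ae_le (ν := ν) ?_ (hAc g hg).abs continuousOn_const hS t ht
    filter_upwards [hf, hA g hg] with s hs hgs
    exact hgs ▸ hs.abs_integral_mul_le hg

theorem exists_weaklyContinuous_representative [SigmaFinite μ] (hM : 0 ≤ M)
    (hS_meas : MeasurableSet S) (hS : S ⊆ closure (interior S))
    (hf : ∀ᵐ t ∂ν.restrict S, IsBetween M (f t) μ)
    (hpair : ∀ ψ : X → ℝ, IsTest ψ → ∃ A : Y → ℝ, ContinuousOn A S ∧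
      ∀ᵐ t ∂ν.restrict S, ∫ x, f t x * ψ x ∂μ = A t) :
    ∃ F : Y → X → ℝ, (∀ t ∈ S, IsBetween M (F t) μ) ∧
      (∀ᵐ t ∂ν.restrict S, F t =ᵐ[μ] f t) ∧
      ∀ g, Integrable g μ → ContinuousOn (fun t => ∫ x, F t x * g x ∂μ) S := by
  choose! A hAc hA using fun g (hg : Integrable g μ) =>
    exists_continuousOn_pairing hM hS_meas hS hf hpair hg
  choose! F hF hFA using fun t (ht : t ∈ S) => exists_isBetween_pairing_eq hM hS hf hAc hA ht
  refine ⟨F, hF, ?_, fun g hg => (hAc g hg).congr fun t ht => (hFA t ht g hg).symm⟩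
  have : ENNReal.HolderConjugate 1 ⊤ := inferInstance
  obtain ⟨ψ, hψ, hsep⟩ := exists_seq_isTest_separating (μ := μ) (F := ℝ) (q := ⊤)
    ENNReal.one_ne_top
  filter_upwards [hf, ae_all_iff.2 fun n => hA _ (hψ n).integrable, ae_restrict_mem hS_meas]
    with t hft hAt ht
  refine (hsep (F t - f t) ((hF t ht).memLp_top.sub hft.memLp_top) fun n => ?_).mono
    fun x hx => sub_eq_zero.1 hx
  have hψn := (hψ n).integrable (μ := μ)
  simp only [Pi.sub_apply, smul_eq_mul, mul_comm (ψ n _), sub_mul]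
  rw [integral_sub ((hF t ht).integrable_mul hψn) (hft.integrable_mul hψn), hAt n,
    hFA t ht _ hψn, sub_self]

end WeaklyContinuous

section ProductSpaces

variable {X Y F : Type*} [MeasurableSpace X] [MeasurableSpace Y] [NormedAddCommGroup F]
  {μ : Measure X} {ν : Measure Y}

theorem ae_memLp_two_prodMk_left [SFinite μ] [SFinite ν] {f : X × Y → F}
    (hf : MemLp f 2 (μ.prod ν)) : ∀ᵐ x ∂μ, MemLp (fun y => f (x, y)) 2 ν := by
  filter_upwards [hf.1.prodMk_left, ((memLp_two_iff_integrable_sq_norm hf.1).1 hf).prod_right_ae]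
    with x hx hx'
  exact (memLp_two_iff_integrable_sq_norm hx).2 hx'

theorem integral_norm_mul_norm_le_sqrt {f g : X → F} (hf : MemLp f 2 μ) (hg : MemLp g 2 μ) :
    ∫ x, ‖f x‖ * ‖g x‖ ∂μ ≤ √(∫ x, ‖f x‖ ^ 2 ∂μ) * √(∫ x, ‖g x‖ ^ 2 ∂μ) := by
  have h2 : ENNReal.ofReal 2 = 2 := by simp
  simpa only [Real.rpow_two, ← Real.sqrt_eq_rpow] using
    integral_mul_norm_le_Lp_mul_Lq Real.HolderConjugate.two_two (h2.symm ▸ hf) (h2.symm ▸ hg)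

variable [NormedSpace ℝ F]

theorem norm_integral_sq_le [IsFiniteMeasure μ] {f : X → F} (hf : MemLp f 2 μ) :
    ‖∫ x, f x ∂μ‖ ^ 2 ≤ μ.real univ * ∫ x, ‖f x‖ ^ 2 ∂μ := by
  have h := integral_norm_mul_norm_le_sqrt (memLp_const (1 : ℝ)) hf.norm
  simp only [norm_one, norm_norm, one_mul, one_pow, integral_const, smul_eq_mul, mul_one] at h
  calc ‖∫ x, f x ∂μ‖ ^ 2 ≤ (√(μ.real univ) * √(∫ x, ‖f x‖ ^ 2 ∂μ)) ^ 2 := by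
        gcongr; exact (norm_integral_le_integral_norm f).trans h
    _ = μ.real univ * ∫ x, ‖f x‖ ^ 2 ∂μ := by
        rw [mul_pow, Real.sq_sqrt measureReal_nonneg,
          Real.sq_sqrt (integral_nonneg fun _ => sq_nonneg _)]

theorem memLp_two_integral_prod [SFinite μ] [IsFiniteMeasure ν] {f : X × Y → F}
    (hf : MemLp f 2 (μ.prod ν)) :
    MemLp (fun x => ∫ y, f (x, y) ∂ν) 2 μ ∧
      ∫ x, ‖∫ y, f (x, y) ∂ν‖ ^ 2 ∂μ ≤ ν.real univ * ∫ q, ‖f q‖ ^ 2 ∂μ.prod ν := by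
  have hmeas : AEStronglyMeasurable (fun x => ∫ y, f (x, y) ∂ν) μ := hf.1.integral_prod_right'
  have hsq : Integrable (fun q => ‖f q‖ ^ 2) (μ.prod ν) := hf.integrable_norm_pow two_ne_zero
  have hle : ∀ᵐ x ∂μ, ‖∫ y, f (x, y) ∂ν‖ ^ 2 ≤ ν.real univ * ∫ y, ‖f (x, y)‖ ^ 2 ∂ν :=
    (ae_memLp_two_prodMk_left hf).mono fun x hx => norm_integral_sq_le hx
  have hdom := hsq.integral_prod_left.const_mul (ν.real univ)
  have hint : Integrable (fun x => ‖∫ y, f (x, y) ∂ν‖ ^ 2) μ :=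
    hdom.mono' (hmeas.norm.pow 2) (hle.mono fun x hx => by rwa [norm_pow, norm_norm])
  refine ⟨(memLp_two_iff_integrable_sq_norm hmeas).2 hint, ?_⟩
  rw [integral_prod _ hsq, ← integral_const_mul]
  exact integral_mono_ae hint hdom hle

theorem integral_prod_restrict_Ioo_le [SFinite μ] {s t : ℝ} (hst : s ≤ t) {f g : ℝ × X → ℝ}
    (hf : ∀ q, 0 ≤ f q) (hfg : ∀ q, f q ≤ g q)
    (hg : Integrable g ((volume.restrict (Ioo 0 t)).prod μ)) :
    ∫ q, f q ∂(volume.restrict (Ioo 0 s)).prod μ ≤ ∫ τ in Ioo 0 t, ∫ x, g (τ, x) ∂μ := by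
  have hle : (volume.restrict (Ioo 0 s)).prod μ ≤ (volume.restrict (Ioo 0 t)).prod μ :=
    Measure.prod_mono (Measure.restrict_mono (Ioo_subset_Ioo_right hst) le_rfl) le_rfl
  rw [← integral_prod g hg]
  exact (integral_mono_of_nonneg (.of_forall hf) (hg.mono_measure hle) (.of_forall hfg)).trans
    (integral_mono_measure hle (.of_forall fun q => (hf q).trans (hfg q)) hg)

end ProductSpaces

section TestFunctions

variable {X Y : Type*} [NormedAddCommGroup X] [NormedSpace ℝ X] [NormedAddCommGroup Y]
  [NormedSpace ℝ Y]

theorem IsTest.mul_prod {ψ : X → ℝ} {χ : Y → ℝ} (hψ : IsTest ψ) (hχ : IsTest χ) :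
    IsTest (fun x : X × Y => ψ x.1 * χ x.2) := by
  refine ⟨(hψ.1.comp contDiff_fst).mul (hχ.1.comp contDiff_snd),
    HasCompactSupport.intro (hψ.2.isCompact.prod hχ.2.isCompact) fun x hx => ?_⟩
  rw [mem_prod, not_and_or] at hx
  rcases hx with hx | hx
  · rw [image_eq_zero_of_notMem_tsupport hx, zero_mul]
  · rw [image_eq_zero_of_notMem_tsupport hx, mul_zero]

theorem IsTest.fderiv_mul_prod {ψ : X → ℝ} {χ : Y → ℝ} (hψ : IsTest ψ) (hχ : IsTest χ)
    (x v : X × Y) : fderiv ℝ (fun x : X × Y => ψ x.1 * χ x.2) x v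
      = fderiv ℝ ψ x.1 v.1 * χ x.2 + ψ x.1 * fderiv ℝ χ x.2 v.2 := by
  have hψ' : HasFDerivAt (fun x : X × Y => ψ x.1) _ x :=
    (hψ.1.differentiable (by simp) x.1).hasFDerivAt.comp x hasFDerivAt_fst
  have hχ' : HasFDerivAt (fun x : X × Y => χ x.2) _ x :=
    (hχ.1.differentiable (by simp) x.2).hasFDerivAt.comp x hasFDerivAt_snd
  rw [(hψ'.fun_mul hχ').fderiv]
  change ψ x.1 * fderiv ℝ χ x.2 v.2 + χ x.2 * fderiv ℝ ψ x.1 v.1 = _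
  ring

end TestFunctions

theorem slabMeasure_eq_prod (ℓ : ℝ) :
    slabMeasure ℓ = (volume : Measure Plane).prod (volume.restrict (Ioo (-ℓ) ℓ)) := by
  rw [slabMeasure, slab, Measure.volume_eq_prod, ← Measure.prod_restrict, Measure.restrict_univ]

theorem cylMeasure_eq_prod (ℓ T : ℝ) :
    cylMeasure ℓ T = (volume.restrict (Ioo 0 T)).prod (slabMeasure ℓ) := by
  rw [cylMeasure, slabMeasure, Measure.volume_eq_prod, ← Measure.prod_restrict]

theorem planeCylMeasure_eq_prod (T : ℝ) :
    planeCylMeasure T = (volume.restrict (Ioo 0 T)).prod (volume : Measure Plane) := by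
  rw [planeCylMeasure, Measure.volume_eq_prod, ← Measure.prod_restrict, Measure.restrict_univ]

instance sigmaFinite_slabMeasure (ℓ : ℝ) : SigmaFinite (slabMeasure ℓ) := by
  rw [slabMeasure]; infer_instance

instance sigmaFinite_planeCylMeasure (T : ℝ) : SigmaFinite (planeCylMeasure T) := by
  rw [planeCylMeasure]; infer_instance

theorem measureReal_restrict_Ioo_neg {ℓ : ℝ} (hℓ : 0 < ℓ) :
    (volume.restrict (Ioo (-ℓ) ℓ)).real univ = 2 * ℓ := by
  rw [measureReal_restrict_apply_univ, Real.volume_real_Ioo_of_le (by linarith)]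
  ring

section VerticalEstimate

variable {ℓ : ℝ} {v : Space3 → Vec3} {G : Space3 → Fin 3 → Vec3} {γp γm : Plane → Vec3}

theorem IsTest.integrable_smul_slab {ψ : Plane → ℝ} (hψ : IsTest ψ) {f : Space3 → Vec3}
    (hf : MemLp f 2 (slabMeasure ℓ)) : Integrable (fun x => ψ x.1 • f x) (slabMeasure ℓ) := by
  have hψ' : MemLp (fun x : Space3 => ψ x.1) 2 (slabMeasure ℓ) := by
    rw [slabMeasure_eq_prod]
    exact (hψ.memLp 2).comp_fst _
  exact memLp_one_iff_integrable.1 (hf.smul hψ')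

theorem IsTest.integrableOn_integral_smul_slab {ψ : Plane → ℝ} (hψ : IsTest ψ) {f : Space3 → Vec3}
    (hf : MemLp f 2 (slabMeasure ℓ)) :
    IntegrableOn (fun z => ∫ y, ψ y • f (y, z)) (Ioo (-ℓ) ℓ) := by
  have h := hψ.integrable_smul_slab hf
  rw [slabMeasure_eq_prod] at h
  exact h.integral_prod_right

theorem IsTest.integrable_mul_smul_slab {ψ : Plane → ℝ} (hψ : IsTest ψ) {χ : ℝ → ℝ}
    (hχ : IsTest χ) {f : Space3 → Vec3} (hf : MemLp f 2 (slabMeasure ℓ)) :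
    Integrable (fun x : Space3 => (ψ x.1 * χ x.2) • f x) (slabMeasure ℓ) :=
  memLp_one_iff_integrable.1 (hf.smul (((hψ.mul_prod hχ).memLp 2 (μ := volume)).restrict _))

theorem IsTest.integral_mul_smul_slab {ψ : Plane → ℝ} (hψ : IsTest ψ) {χ : ℝ → ℝ}
    (hχ : IsTest χ) {f : Space3 → Vec3} (hf : MemLp f 2 (slabMeasure ℓ)) :
    ∫ x, (ψ x.1 * χ x.2) • f x ∂slabMeasure ℓ
      = ∫ z in Ioo (-ℓ) ℓ, χ z • ∫ y, ψ y • f (y, z) := by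
  have h := hψ.integrable_mul_smul_slab hχ hf
  rw [slabMeasure_eq_prod] at h ⊢
  rw [integral_prod_symm _ h]
  simp only [mul_comm (ψ _), mul_smul, integral_smul]

theorem IsTrace.integral_deriv_smul_add (h : IsTrace ℓ v G γp γm)
    (hv : MemLp v 2 (slabMeasure ℓ)) (hG : MemLp (fun x => G x 2) 2 (slabMeasure ℓ))
    {ψ : Plane → ℝ} (hψ : IsTest ψ) {θ : ℝ → ℝ} (hθ : IsTest θ) (hθℓ : θ ℓ = 0) :
    ∫ z in Ioo (-ℓ) ℓ, (deriv θ z • (∫ y, ψ y • v (y, z)) + θ z • ∫ y, ψ y • G (y, z) 2)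
      = -(θ (-ℓ) • ∫ y, ψ y • γm y) := by
  have hpd : ∀ x, pd 2 (fun x : Space3 => ψ x.1 * θ x.2) x = ψ x.1 * deriv θ x.2 := fun x => by
    simp [pd, hψ.fderiv_mul_prod hθ, dir]
  have htr := h _ (hψ.mul_prod hθ)
  simp only [hpd, hθℓ, mul_zero, zero_smul, zero_sub, integral_neg] at htr
  rw [← slabMeasure, integral_add (hψ.integrable_mul_smul_slab hθ.deriv hv)
    (hψ.integrable_mul_smul_slab hθ hG), hψ.integral_mul_smul_slab hθ.deriv hv,
    hψ.integral_mul_smul_slab hθ hG] at htr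
  have hint : ∀ {χ : ℝ → ℝ} {f : Space3 → Vec3}, IsTest χ → MemLp f 2 (slabMeasure ℓ) →
      IntegrableOn (fun z => χ z • ∫ y, ψ y • f (y, z)) (Ioo (-ℓ) ℓ) := fun hχ hf =>
    (hψ.integrableOn_integral_smul_slab hf).smul_of_top_right ((hχ.memLp ⊤).restrict _)
  rw [integral_add (hint hθ.deriv hv) (hint hθ hG), htr]
  simp only [mul_comm (ψ _), mul_smul, integral_smul]

theorem IsTrace.ae_integral_smul_eq (hℓ : 0 < ℓ) (h : IsTrace ℓ v G γp γm)
    (hv : MemLp v 2 (slabMeasure ℓ)) (hG : MemLp (fun x => G x 2) 2 (slabMeasure ℓ))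
    {ψ : Plane → ℝ} (hψ : IsTest ψ) :
    ∀ᵐ z ∂volume.restrict (Ioo (-ℓ) ℓ), ∫ y, ψ y • v (y, z)
      = (∫ y, ψ y • γm y) + ∫ s in Ioc (-ℓ) z, ∫ y, ψ y • G (y, s) 2 :=
  ae_eq_add_primitive (by linarith) (hψ.integrableOn_integral_smul_slab hv)
    (hψ.integrableOn_integral_smul_slab hG) fun _ hθ hθℓ =>
    h.integral_deriv_smul_add hv hG hψ hθ (image_eq_zero_of_notMem_tsupport
      fun hmem => lt_irrefl ℓ (hθℓ hmem))

theorem prod_restrict_Ioc_le_slabMeasure {z : ℝ} (hz : z ∈ Ioo (-ℓ) ℓ) :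
    (volume : Measure Plane).prod (volume.restrict (Ioc (-ℓ) z)) ≤ slabMeasure ℓ := by
  have hsub : Ioc (-ℓ) z ⊆ Ioo (-ℓ) ℓ := fun s hs => ⟨hs.1, hs.2.trans_lt hz.2⟩
  rw [slabMeasure_eq_prod]
  exact Measure.prod_mono le_rfl (Measure.restrict_mono hsub le_rfl)

theorem memLp_two_primitive_slab {f : Space3 → Vec3} (hf : MemLp f 2 (slabMeasure ℓ)) {z : ℝ}
    (hz : z ∈ Ioo (-ℓ) ℓ) :
    MemLp (fun y => ∫ s in Ioc (-ℓ) z, f (y, s)) 2 ∧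
      ∫ y, ‖∫ s in Ioc (-ℓ) z, f (y, s)‖ ^ 2 ≤ 2 * ℓ * ∫ x, ‖f x‖ ^ 2 ∂slabMeasure ℓ := by
  have hle := prod_restrict_Ioc_le_slabMeasure hz
  obtain ⟨hP, hP2⟩ := memLp_two_integral_prod (hf.mono_measure hle)
  refine ⟨hP, hP2.trans (mul_le_mul ?_ (integral_mono_measure hle (.of_forall fun _ => sq_nonneg _)
    (hf.integrable_norm_pow two_ne_zero)) (integral_nonneg fun _ => sq_nonneg _) ?_)⟩
  · rw [measureReal_restrict_apply_univ, Real.volume_real_Ioc_of_le hz.1.le]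
    linarith [hz.2]
  · linarith [hz.1.trans hz.2]

theorem IsTrace.ae_eq_add_primitive (hℓ : 0 < ℓ) (h : IsTrace ℓ v G γp γm)
    (hv : MemLp v 2 (slabMeasure ℓ)) (hG : MemLp (fun x => G x 2) 2 (slabMeasure ℓ))
    (hγ : MemLp γm 2 volume) :
    ∀ᵐ z ∂volume.restrict (Ioo (-ℓ) ℓ), ∀ᵐ y, v (y, z) = γm y + ∫ s in Ioc (-ℓ) z, G (y, s) 2 := by
  obtain ⟨ψ, hψ, hsep⟩ := exists_seq_isTest_separating (μ := (volume : Measure Plane)) (F := Vec3)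
    (p := 2) (q := 2) ENNReal.ofNat_ne_top
  have hv' : MemLp (fun q : ℝ × Plane => v (q.2, q.1)) 2
      ((volume.restrict (Ioo (-ℓ) ℓ)).prod volume) := by
    rw [slabMeasure_eq_prod] at hv
    exact hv.comp_measurePreserving Measure.measurePreserving_swap
  filter_upwards [ae_all_iff.2 fun n => h.ae_integral_smul_eq hℓ hv hG (hψ n),
    ae_memLp_two_prodMk_left hv', ae_restrict_mem measurableSet_Ioo] with z hz hvz hzℓ
  have hGz := hG.mono_measure (prod_restrict_Ioc_le_slabMeasure hzℓ)
  have hP := (memLp_two_primitive_slab hG hzℓ).1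
  refine (hsep _ (hvz.sub (hγ.add hP)) fun n => ?_).mono fun y hy => sub_eq_zero.1 hy
  have hψL : ∀ {f : Plane → Vec3}, MemLp f 2 → Integrable fun y => ψ n y • f y := fun hf =>
    memLp_one_iff_integrable.1 (hf.smul ((hψ n).memLp 2))
  have hfubini : ∫ y, ψ n y • ∫ s in Ioc (-ℓ) z, G (y, s) 2
      = ∫ s in Ioc (-ℓ) z, ∫ y, ψ n y • G (y, s) 2 := by
    simp only [← integral_smul]
    exact integral_integral_swap
      (memLp_one_iff_integrable.1 (hGz.smul (((hψ n).memLp 2).comp_fst _)))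
  simp only [Pi.sub_apply, smul_sub]
  rw [integral_sub (hψL hvz) (hψL (hγ.add hP))]
  simp only [Pi.add_apply, smul_add]
  rw [integral_add (hψL hγ) (hψL hP), hfubini]
  exact sub_eq_zero.2 (hz n)

theorem IsTrace.integral_norm_sq_le (hℓ : 0 < ℓ) (h : IsTrace ℓ v G γp γm)
    (hv : MemLp v 2 (slabMeasure ℓ)) (hG : MemLp (fun x => G x 2) 2 (slabMeasure ℓ))
    (hγ : MemLp γm 2 volume) :
    ∫ x, ‖v x‖ ^ 2 ∂slabMeasure ℓ
      ≤ 4 * ℓ * (∫ y, ‖γm y‖ ^ 2) + 8 * ℓ ^ 2 * ∫ x, ‖G x 2‖ ^ 2 ∂slabMeasure ℓ := by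
  set g := ∫ x, ‖G x 2‖ ^ 2 ∂slabMeasure ℓ
  have hv2 := hv.integrable_norm_pow two_ne_zero
  rw [slabMeasure_eq_prod] at hv2 ⊢
  have hslice : ∀ᵐ z ∂volume.restrict (Ioo (-ℓ) ℓ),
      ∫ y, ‖v (y, z)‖ ^ 2 ≤ 2 * (∫ y, ‖γm y‖ ^ 2) + 4 * ℓ * g := by
    filter_upwards [h.ae_eq_add_primitive hℓ hv hG hγ, ae_restrict_mem measurableSet_Ioo]
      with z hz hzℓ
    obtain ⟨hP, hP2⟩ := memLp_two_primitive_slab hG hzℓ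
    have hγ2 := (hγ.integrable_norm_pow two_ne_zero).const_mul 2
    have hP2' := (hP.integrable_norm_pow two_ne_zero).const_mul 2
    calc ∫ y, ‖v (y, z)‖ ^ 2
        ≤ ∫ y, (2 * ‖γm y‖ ^ 2 + 2 * ‖∫ s in Ioc (-ℓ) z, G (y, s) 2‖ ^ 2) := by
          refine integral_mono_of_nonneg (.of_forall fun _ => sq_nonneg _) (hγ2.add hP2') ?_
          filter_upwards [hz] with y hy
          rw [hy, ← mul_add]
          exact (pow_le_pow_left₀ (norm_nonneg _) (norm_add_le _ _) 2).trans add_sq_le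
      _ ≤ 2 * (∫ y, ‖γm y‖ ^ 2) + 4 * ℓ * g := by
          rw [integral_add hγ2 hP2', integral_const_mul, integral_const_mul]
          linarith
  calc ∫ x, ‖v x‖ ^ 2 ∂volume.prod (volume.restrict (Ioo (-ℓ) ℓ))
      = ∫ z in Ioo (-ℓ) ℓ, ∫ y, ‖v (y, z)‖ ^ 2 := integral_prod_symm _ hv2
    _ ≤ ∫ z in Ioo (-ℓ) ℓ, (2 * (∫ y, ‖γm y‖ ^ 2) + 4 * ℓ * g) :=
        integral_mono_ae hv2.integral_prod_right (integrable_const _) hslice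
    _ = 4 * ℓ * (∫ y, ‖γm y‖ ^ 2) + 8 * ℓ ^ 2 * g := by
        rw [integral_const, measureReal_restrict_Ioo_neg hℓ, smul_eq_mul]
        ring

end VerticalEstimate

section Energy

variable {ℓ α e C T : ℝ} {ρin : Space3 → ℝ} {ρ : ℝ → Space3 → ℝ}
  {u : ℝ → Space3 → Vec3} {Du : ℝ → Space3 → Fin 3 → Vec3} {γp γm : ℝ → Plane → Vec3}

theorem IsVelocity.integral_norm_sq_le (hℓ : 0 < ℓ) (h : IsVelocity ℓ u Du γp γm) (hT : 0 < T) :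
    ∫ q, ‖u q.1 q.2‖ ^ 2 ∂cylMeasure ℓ T
      ≤ 4 * ℓ * (∫ q, ‖γm q.1 q.2‖ ^ 2 ∂planeCylMeasure T)
        + 8 * ℓ ^ 2 * ∫ q, ‖Du q.1 q.2 2‖ ^ 2 ∂cylMeasure ℓ T := by
  have hu := h.memLp T hT
  have hD := h.grad_memLp T hT 2
  have hγ := (h.trace_memLp T hT).2
  rw [cylMeasure_eq_prod] at hu hD ⊢
  rw [planeCylMeasure_eq_prod] at hγ ⊢
  have hu2 := hu.integrable_norm_pow two_ne_zero
  have hD2 := hD.integrable_norm_pow two_ne_zero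
  have hγ2 := hγ.integrable_norm_pow two_ne_zero
  have hD3 := hD2.integral_prod_left.const_mul (8 * ℓ ^ 2)
  have hγ3 := hγ2.integral_prod_left.const_mul (4 * ℓ)
  rw [integral_prod _ hu2, integral_prod _ hD2, integral_prod _ hγ2, ← integral_const_mul,
    ← integral_const_mul, ← integral_add hγ3 hD3]
  refine integral_mono_ae hu2.integral_prod_left (hγ3.add hD3) ?_
  filter_upwards [ae_memLp_two_prodMk_left hu, ae_memLp_two_prodMk_left hD,
    ae_memLp_two_prodMk_left hγ, ae_restrict_of_ae_restrict_of_subset Ioo_subset_Ioi_self h.trace]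
    with t hut hDt hγt htr
  exact htr.integral_norm_sq_le hℓ hut hDt hγt

theorem ae_restrict_Ioi_of_forall_Ioo {P : ℝ → Prop}
    (h : ∀ T > 0, ∀ᵐ t ∂volume.restrict (Ioo 0 T), P t) : ∀ᵐ t ∂volume.restrict (Ioi 0), P t := by
  have hcover : Ioi (0 : ℝ) ⊆ ⋃ n : ℕ, Ioo (0 : ℝ) (n + 1) := fun t ht =>
    let ⟨n, hn⟩ := exists_nat_gt t
    mem_iUnion.2 ⟨n, ht, hn.trans (lt_add_one _)⟩
  exact ae_restrict_of_ae_restrict_of_subset hcover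
    ((ae_restrict_iUnion_iff _ _).2 fun n => h _ n.cast_add_one_pos)

theorem exists_gt_of_ae_restrict_Ioi {P : ℝ → Prop} (hP : ∀ᵐ t ∂volume.restrict (Ioi 0), P t)
    (hT : 0 < T) : ∃ t > T, P t := by
  have hP' := ae_restrict_of_ae_restrict_of_subset (Ioi_subset_Ioi hT.le) hP
  have : NeZero ((volume : Measure ℝ).restrict (Ioi T)) := ⟨by simp⟩
  obtain ⟨t, ht, hPt⟩ := ((ae_restrict_mem measurableSet_Ioi).and hP').exists
  exact ⟨t, ht, hPt⟩

theorem IsVelocity.dissipation_le (hα : 0 ≤ α) (h : IsVelocity ℓ u Du γp γm)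
    (he : ∀ᵐ t ∂volume.restrict (Ioi 0),
      (∫ τ in Ioo 0 t, ∫ x in slab ℓ, ∑ j : Fin 3, ‖Du τ x j‖ ^ 2)
        + 2 * α * (∫ τ in Ioo 0 t, ∫ y : Plane, (‖γp τ y‖ ^ 2 + ‖γm τ y‖ ^ 2)) ≤ e)
    (hT : 0 < T) :
    (∫ q, ‖Du q.1 q.2 2‖ ^ 2 ∂cylMeasure ℓ T)
      + 2 * α * (∫ q, ‖γm q.1 q.2‖ ^ 2 ∂planeCylMeasure T) ≤ e := by
  obtain ⟨t, hTt, het⟩ := exists_gt_of_ae_restrict_Ioi he hT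
  have hD := h.grad_memLp t (hT.trans hTt)
  obtain ⟨hγp, hγm⟩ := h.trace_memLp t (hT.trans hTt)
  simp only [cylMeasure_eq_prod] at hD ⊢
  rw [planeCylMeasure_eq_prod] at hγp hγm ⊢
  have hgrad : ∫ q, ‖Du q.1 q.2 2‖ ^ 2 ∂(volume.restrict (Ioo 0 T)).prod (slabMeasure ℓ)
      ≤ ∫ τ in Ioo 0 t, ∫ x in slab ℓ, ∑ j : Fin 3, ‖Du τ x j‖ ^ 2 :=
    integral_prod_restrict_Ioo_le hTt.le (fun _ => sq_nonneg _)
      (fun q => Finset.single_le_sum (f := fun j => ‖Du q.1 q.2 j‖ ^ 2) (fun j _ => sq_nonneg _)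
        (Finset.mem_univ 2))
      (integrable_finsetSum _ fun j _ => (hD j).integrable_norm_pow two_ne_zero)
  have htrace : ∫ q, ‖γm q.1 q.2‖ ^ 2 ∂(volume.restrict (Ioo 0 T)).prod volume
      ≤ ∫ τ in Ioo 0 t, ∫ y : Plane, (‖γp τ y‖ ^ 2 + ‖γm τ y‖ ^ 2) :=
    integral_prod_restrict_Ioo_le hTt.le (fun _ => sq_nonneg _)
      (fun q => le_add_of_nonneg_left (sq_nonneg ‖γp q.1 q.2‖))
      ((hγp.integrable_norm_pow two_ne_zero).add (hγm.integrable_norm_pow two_ne_zero))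
  exact (add_le_add hgrad (mul_le_mul_of_nonneg_left htrace (by positivity))).trans het

/-- `u` transports the initial density `ρin` and dissipates, in the bulk and by friction on the
faces, a total energy of at most `e`: what remains of a global finite energy weak solution without
its momentum equation and its kinetic energy. -/
structure IsFiniteEnergyTransport (ℓ α e : ℝ) (ρin : Space3 → ℝ) (ρ : ℝ → Space3 → ℝ)
    (u : ℝ → Space3 → Vec3) : Prop where
  memLp : ∀ T, 0 < T → MemLp (fun q : ℝ × Space3 => ρ q.1 q.2) ⊤ (cylMeasure ℓ T)
  nonneg : ∀ T, 0 < T → ∀ᵐ q ∂cylMeasure ℓ T, 0 ≤ ρ q.1 q.2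
  solvesMass : SolvesMass ℓ ρin ρ u
  velocity : ∃ (Du : ℝ → Space3 → Fin 3 → Vec3) (γp γm : ℝ → Plane → Vec3),
    IsVelocity ℓ u Du γp γm ∧ ∀ᵐ t ∂volume.restrict (Ioi 0),
      (∫ τ in Ioo 0 t, ∫ x in slab ℓ, ∑ j : Fin 3, ‖Du τ x j‖ ^ 2)
        + 2 * α * (∫ τ in Ioo 0 t, ∫ y : Plane, (‖γp τ y‖ ^ 2 + ‖γm τ y‖ ^ 2)) ≤ e

theorem IsFiniteEnergyWeakSolution.isFiniteEnergyTransport {ε : ℝ} {m : Space3 → Vec3}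
    (h : IsFiniteEnergyWeakSolution ε ℓ α ρin m ρ u) :
    IsFiniteEnergyTransport ℓ α (∫ x in slab ℓ, ‖m x‖ ^ 2 / ρin x) ρin ρ u := by
  obtain ⟨hρ, hmass, Du, γp, γm, hu, -, henergy⟩ := h
  refine ⟨fun T hT => (hρ T hT).1, fun T hT => (hρ T hT).2, hmass, Du, γp, γm, hu, ?_⟩
  have hρ0 : ∀ᵐ t ∂volume.restrict (Ioi 0), ∀ᵐ x ∂slabMeasure ℓ, 0 ≤ ρ t x :=
    ae_restrict_Ioi_of_forall_Ioo fun T hT =>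
      Measure.ae_ae_of_ae_prod (cylMeasure_eq_prod ℓ T ▸ (hρ T hT).2)
  filter_upwards [hρ0, henergy] with t hρt ht
  have hkinetic : 0 ≤ ∫ x in slab ℓ, ρ t x * ‖u t x‖ ^ 2 :=
    integral_nonneg_of_ae (hρt.mono fun x hx => mul_nonneg hx (sq_nonneg _))
  linarith

theorem IsFiniteEnergyTransport.memLp_velocity (h : IsFiniteEnergyTransport ℓ α e ρin ρ u)
    (hT : 0 < T) : MemLp (fun q : ℝ × Space3 => u q.1 q.2) 2 (cylMeasure ℓ T) :=
  let ⟨_, _, _, hu, _⟩ := h.velocity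
  hu.memLp T hT

/-- The vertical mean `(2ℓ)⁻¹ ∫∫ |u|²` of the squared velocity over `]0,T[ × Ω`. -/
noncomputable def meanVelocitySq (ℓ T : ℝ) (u : ℝ → Space3 → Vec3) : ℝ :=
  (2 * ℓ)⁻¹ * ∫ q, ‖u q.1 q.2‖ ^ 2 ∂cylMeasure ℓ T

theorem meanVelocitySq_nonneg (hℓ : 0 < ℓ) : 0 ≤ meanVelocitySq ℓ T u :=
  mul_nonneg (by positivity) (integral_nonneg fun _ => sq_nonneg _)

theorem IsFiniteEnergyTransport.meanVelocitySq_le (hℓ : 0 < ℓ) (hα : 0 < α)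
    (h : IsFiniteEnergyTransport ℓ α e ρin ρ u)
    (hC : (2 * ℓ)⁻¹ * e ≤ C) (hT : 0 < T) :
    meanVelocitySq ℓ T u ≤ 2 * C * (α / ℓ)⁻¹ + 8 * C * ℓ ^ 2 := by
  obtain ⟨Du, γp, γm, hu, he⟩ := h.velocity
  have hdiss := hu.dissipation_le hα.le he hT
  have hu2 := hu.integral_norm_sq_le hℓ hT
  rw [inv_mul_le_iff₀ (by positivity)] at hC
  set a := ∫ q, ‖Du q.1 q.2 2‖ ^ 2 ∂cylMeasure ℓ T
  set b := ∫ q, ‖γm q.1 q.2‖ ^ 2 ∂planeCylMeasure T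
  have ha : 0 ≤ a := integral_nonneg fun _ => sq_nonneg _
  have hb : 0 ≤ 2 * α * b := mul_nonneg (by positivity) (integral_nonneg fun _ => sq_nonneg _)
  have ha' : a ≤ 2 * ℓ * C := by linarith
  have hb' : b ≤ ℓ * C / α := by rw [le_div_iff₀ hα]; linarith
  rw [meanVelocitySq, inv_mul_le_iff₀ (by positivity)]
  calc _ ≤ 4 * ℓ * b + 8 * ℓ ^ 2 * a := hu2
    _ ≤ 4 * ℓ * (ℓ * C / α) + 8 * ℓ ^ 2 * (2 * ℓ * C) := by gcongr
    _ = 2 * ℓ * (2 * C * (α / ℓ)⁻¹ + 8 * C * ℓ ^ 2) := by field_simp; ring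

theorem tendsto_meanVelocitySq {E : Set ℝ} {ℓ α e : ℝ → ℝ} {ρin : ℝ → Space3 → ℝ}
    {ρ : ℝ → ℝ → Space3 → ℝ} {u : ℝ → ℝ → Space3 → Vec3}
    (hℓ_pos : ∀ ε ∈ E, 0 < ℓ ε) (hℓ_lim : Tendsto ℓ (𝓝[E] 0) (𝓝 0))
    (hlam : Tendsto (fun ε => α ε / ℓ ε) (𝓝[E] 0) atTop)
    (hC : ∀ ε ∈ E, (2 * ℓ ε)⁻¹ * e ε ≤ C)
    (hsol : ∀ ε ∈ E, IsFiniteEnergyTransport (ℓ ε) (α ε) (e ε) (ρin ε) (ρ ε) (u ε)) (hT : 0 < T) :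
    Tendsto (fun ε => meanVelocitySq (ℓ ε) T (u ε)) (𝓝[E] 0) (𝓝 0) := by
  have hbound : Tendsto (fun ε => 2 * C * (α ε / ℓ ε)⁻¹ + 8 * C * ℓ ε ^ 2) (𝓝[E] 0) (𝓝 0) := by
    simpa using (hlam.inv_tendsto_atTop.const_mul (2 * C)).add ((hℓ_lim.pow 2).const_mul (8 * C))
  refine squeeze_zero' ?_ ?_ hbound
  · filter_upwards [self_mem_nhdsWithin] with ε hε
    exact meanVelocitySq_nonneg (hℓ_pos ε hε)
  · filter_upwards [self_mem_nhdsWithin, hlam.eventually_gt_atTop 0] with ε hε hαℓ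
    have hα : 0 < α ε := (div_pos_iff_of_pos_right (hℓ_pos ε hε)).1 hαℓ
    exact (hsol ε hε).meanVelocitySq_le (hℓ_pos ε hε) hα (hC ε hε) hT

end Energy

section Average

variable {X Y F : Type*} [MeasurableSpace X] [MeasurableSpace Y] {μ : Measure X} {ν : Measure Y}
  [NormedAddCommGroup F] [NormedSpace ℝ F] {M : ℝ}

theorem IsBetween.average_prod [SFinite μ] [IsFiniteMeasure ν] [NeZero ν] {f : X × Y → ℝ}
    (hf : IsBetween M f (μ.prod ν)) : IsBetween M (fun x => ⨍ y, f (x, y) ∂ν) μ := by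
  constructor
  · simp only [average_eq]
    exact hf.1.integral_prod_right'.const_smul (ν.real univ)⁻¹
  · filter_upwards [hf.ae_prodMk_left] with x hx
    exact (convex_Icc 0 M).average_mem isClosed_Icc hx.2 (hx.memLp_top.integrable le_top)

theorem IsBetween.integral_mul_fst [SFinite μ] [IsFiniteMeasure ν] {f : X × Y → ℝ}
    (hf : IsBetween M f (μ.prod ν)) {g : X → ℝ} (hg : Integrable g μ) :
    ∫ q, f q * g q.1 ∂μ.prod ν = ν.real univ * ∫ x, (⨍ y, f (x, y) ∂ν) * g x ∂μ := by
  rw [integral_prod _ (hf.integrable_mul (hg.comp_fst ν)), ← integral_const_mul]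
  refine integral_congr_ae (.of_forall fun x => ?_)
  simp only [integral_mul_const]
  rw [← mul_assoc, ← smul_eq_mul (ν.real univ), measure_smul_average]

theorem memLp_two_average_prod [SFinite μ] [IsFiniteMeasure ν] [NeZero ν] {f : X × Y → F}
    (hf : MemLp f 2 (μ.prod ν)) :
    MemLp (fun x => ⨍ y, f (x, y) ∂ν) 2 μ ∧
      ∫ x, ‖⨍ y, f (x, y) ∂ν‖ ^ 2 ∂μ ≤ (ν.real univ)⁻¹ * ∫ q, ‖f q‖ ^ 2 ∂μ.prod ν := by
  obtain ⟨hmem, hle⟩ := memLp_two_integral_prod hf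
  have hν : 0 < ν.real univ := measureReal_univ_pos
  simp only [average_eq]
  refine ⟨hmem.const_smul _, ?_⟩
  simp only [norm_smul, mul_pow, integral_const_mul]
  rw [norm_inv, Real.norm_of_nonneg hν.le]
  calc _ ≤ (ν.real univ)⁻¹ ^ 2 * (ν.real univ * ∫ q, ‖f q‖ ^ 2 ∂μ.prod ν) := by gcongr
    _ = (ν.real univ)⁻¹ * ∫ q, ‖f q‖ ^ 2 ∂μ.prod ν := by field_simp

end Average

section VerticalAverage

variable {ℓ T M : ℝ}

theorem vAvg_eq_average {F : Type*} [NormedAddCommGroup F] [NormedSpace ℝ F] (hℓ : 0 < ℓ)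
    (f : Space3 → F) (y : Plane) : vAvg ℓ f y = ⨍ z in Ioo (-ℓ) ℓ, f (y, z) := by
  rw [vAvg, average_eq, measureReal_restrict_Ioo_neg hℓ]

theorem neZero_restrict_Ioo_neg (hℓ : 0 < ℓ) :
    NeZero ((volume : Measure ℝ).restrict (Ioo (-ℓ) ℓ)) :=
  ⟨Measure.restrict_eq_zero.not.2 (by simpa using hℓ)⟩

theorem measurePreserving_prodAssoc_cyl (ℓ T : ℝ) :
    MeasurePreserving (MeasurableEquiv.prodAssoc : (ℝ × Plane) × ℝ ≃ᵐ ℝ × Space3)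
      ((planeCylMeasure T).prod (volume.restrict (Ioo (-ℓ) ℓ))) (cylMeasure ℓ T) := by
  rw [planeCylMeasure_eq_prod, cylMeasure_eq_prod, slabMeasure_eq_prod]
  exact measurePreserving_prodAssoc _ _ _

theorem isBetween_vAvg (hℓ : 0 < ℓ) {f : Space3 → ℝ} (hf : IsBetween M f (slabMeasure ℓ)) :
    IsBetween M (vAvg ℓ f) volume := by
  have := neZero_restrict_Ioo_neg hℓ
  simp only [funext (vAvg_eq_average hℓ f)]
  exact IsBetween.average_prod (slabMeasure_eq_prod ℓ ▸ hf)

theorem isBetween_vAvg_cyl (hℓ : 0 < ℓ) {f : ℝ → Space3 → ℝ}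
    (hf : IsBetween M (fun q : ℝ × Space3 => f q.1 q.2) (cylMeasure ℓ T)) :
    IsBetween M (fun q : ℝ × Plane => vAvg ℓ (f q.1) q.2) (planeCylMeasure T) := by
  have := neZero_restrict_Ioo_neg hℓ
  have hp := measurePreserving_prodAssoc_cyl ℓ T
  simp only [vAvg_eq_average hℓ]
  exact IsBetween.average_prod
    ⟨hf.1.comp_measurePreserving hp, hp.quasiMeasurePreserving.ae hf.2⟩

theorem integral_slab_mul_comp_fst (hℓ : 0 < ℓ) {f : Space3 → ℝ}
    (hf : IsBetween M f (slabMeasure ℓ)) {g : Plane → ℝ} (hg : Integrable g) :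
    ∫ x, f x * g x.1 ∂slabMeasure ℓ = 2 * ℓ * ∫ y, vAvg ℓ f y * g y := by
  rw [slabMeasure_eq_prod] at hf ⊢
  simp only [hf.integral_mul_fst hg, measureReal_restrict_Ioo_neg hℓ, vAvg_eq_average hℓ]

theorem memLp_two_vAvg_cyl {F : Type*} [NormedAddCommGroup F] [NormedSpace ℝ F] (hℓ : 0 < ℓ)
    {f : ℝ → Space3 → F} (hf : MemLp (fun q : ℝ × Space3 => f q.1 q.2) 2 (cylMeasure ℓ T)) :
    MemLp (fun q : ℝ × Plane => vAvg ℓ (f q.1) q.2) 2 (planeCylMeasure T) ∧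
      ∫ q, ‖vAvg ℓ (f q.1) q.2‖ ^ 2 ∂planeCylMeasure T
        ≤ (2 * ℓ)⁻¹ * ∫ q, ‖f q.1 q.2‖ ^ 2 ∂cylMeasure ℓ T := by
  have := neZero_restrict_Ioo_neg hℓ
  have hp := measurePreserving_prodAssoc_cyl ℓ T
  simp only [vAvg_eq_average hℓ]
  rw [← hp.integral_comp', ← measureReal_restrict_Ioo_neg hℓ]
  exact memLp_two_average_prod (hf.comp_measurePreserving hp)

end VerticalAverage

section MassBalance

variable {ℓ T M : ℝ} {ρin : Space3 → ℝ} {ρ b : ℝ → Space3 → ℝ} {u : ℝ → Space3 → Vec3}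
  {β : ℝ → ℝ} {ψ : Plane → ℝ}

theorem exists_isTest_eq_one {X : Type*} [NormedAddCommGroup X] [NormedSpace ℝ X]
    [HasContDiffBump X] [FiniteDimensional ℝ X] (r : ℝ) :
    ∃ κ : X → ℝ, IsTest κ ∧ (∀ x, 0 ≤ κ x) ∧ ∀ x, ‖x‖ ≤ r → κ x = 1 := by
  let κ : ContDiffBump (0 : X) := ⟨|r| + 1, |r| + 2, by positivity, by linarith⟩
  refine ⟨κ, ⟨κ.contDiff, κ.hasCompactSupport⟩, fun _ => κ.nonneg, fun x hx =>
    κ.one_of_mem_closedBall (mem_closedBall_zero_iff.2 ?_)⟩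
  linarith [le_abs_self r]

/-- The horizontal part `w_h` of a vector `w = (w_h, w_3)`. -/
noncomputable def horizontal (w : Vec3) : Plane := !₂[w 0, w 1]

theorem continuous_horizontal : Continuous horizontal := by
  unfold horizontal
  fun_prop

theorem norm_horizontal_le (w : Vec3) : ‖horizontal w‖ ≤ ‖w‖ := by
  rw [EuclideanSpace.norm_eq, EuclideanSpace.norm_eq, Fin.sum_univ_two, Fin.sum_univ_three]
  exact Real.sqrt_le_sqrt (le_add_of_nonneg_right (sq_nonneg ‖w 2‖))

theorem IsTest.sum_mul_pd_fst (hψ : IsTest ψ) (c : ℝ) (w : Vec3) (x : Space3) :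
    ∑ j, w j * pd j (fun y : Space3 => c * ψ y.1) x
      = c * fderiv ℝ ψ x.1 (horizontal w) := by
  have hψ' : HasFDerivAt (fun y : Space3 => ψ y.1) _ x :=
    (hψ.1.differentiable (by simp) x.1).hasFDerivAt.comp x hasFDerivAt_fst
  have hpd : ∀ j, pd j (fun y : Space3 => c * ψ y.1) x = c * fderiv ℝ ψ x.1 (dir j).1 := fun j => by
    rw [pd, (hψ'.const_mul c).fderiv]
    rfl
  have hw : horizontal w = w 0 • EuclideanSpace.single 0 1 + w 1 • EuclideanSpace.single 1 1 := by
    ext i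
    fin_cases i <;> simp [horizontal]
  simp only [hpd, Fin.sum_univ_three, dir, Matrix.cons_val, map_zero, hw, map_add, map_smul,
    smul_eq_mul]
  ring

/-- The flux `∫_Ω b u_h · ∇_h ψ dx` driving the evolution of `∫_Ω b ψ dx` when `b` is transported
by `u` and `ψ` depends on the horizontal variables only. -/
noncomputable def horizontalFlux (ℓ : ℝ) (b : ℝ → Space3 → ℝ) (u : ℝ → Space3 → Vec3)
    (ψ : Plane → ℝ) (t : ℝ) : ℝ :=
  ∫ x, b t x * fderiv ℝ ψ x.1 (horizontal (u t x)) ∂slabMeasure ℓ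

theorem SolvesMass.integral_tensor (h : SolvesMass ℓ ρin ρ u) (hβ : IsC1b β) {θ : ℝ → ℝ}
    (hθ : IsTest θ) (hψ : IsTest ψ) :
    ∫ t in Ioi 0, ∫ x, β (ρ t x) * (deriv θ t * ψ x.1
        + θ t * fderiv ℝ ψ x.1 (horizontal (u t x))) ∂slabMeasure ℓ
      = -(θ 0 * ∫ x, β (ρin x) * ψ x.1 ∂slabMeasure ℓ) := by
  obtain ⟨κ, hκ, -, hκ1⟩ := exists_isTest_eq_one (X := ℝ) ℓ
  have hslab : MeasurableSet (slab ℓ) := MeasurableSet.univ.prod measurableSet_Ioo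
  have hκx : ∀ x ∈ slab ℓ, κ x.2 = 1 := fun x hx => hκ1 _ (abs_le.2 ⟨hx.2.1.le, hx.2.2.le⟩)
  have hnhds : ∀ x ∈ slab ℓ, ∀ c : ℝ,
      (fun y : Space3 => c * (ψ y.1 * κ y.2)) =ᶠ[𝓝 x] fun y => c * ψ y.1 := fun x hx c => by
    filter_upwards [(isOpen_univ.prod isOpen_Ioo).mem_nhds hx] with y hy
    rw [hκx y hy, mul_one]
  have key := h β hβ _ (hθ.mul_prod (hψ.mul_prod hκ))
  rw [neg_eq_iff_eq_neg] at key
  convert! key using 2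
  · funext t
    refine setIntegral_congr_fun hslab fun x hx => ?_
    simp only [pd, (hnhds x hx (θ t)).fderiv_eq, deriv_mul_const_field, hκx x hx, mul_one]
    rw [← hψ.sum_mul_pd_fst]
    rfl
  · rw [← integral_const_mul]
    refine setIntegral_congr_fun hslab fun x hx => ?_
    simp only [hκx x hx]
    ring

theorem memLp_comp_fst_cyl {F : Type*} [NormedAddCommGroup F] {g : Plane → F} {p : ℝ≥0∞}
    (hg : MemLp g p) : MemLp (fun q : ℝ × Space3 => g q.2.1) p (cylMeasure ℓ T) := by
  rw [cylMeasure_eq_prod, slabMeasure_eq_prod]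
  exact (hg.comp_fst _).comp_snd _

theorem IsTest.memLp_fderiv (hψ : IsTest ψ) (p : ℝ≥0∞) : MemLp (fderiv ℝ ψ) p :=
  (hψ.1.continuous_fderiv (by simp)).memLp_of_hasCompactSupport (hψ.2.fderiv ℝ)

theorem norm_fderiv_horizontal_le (ψ : Plane → ℝ) (y : Plane) (w : Vec3) :
    ‖fderiv ℝ ψ y (horizontal w)‖ ≤ ‖w‖ * ‖fderiv ℝ ψ y‖ := by
  rw [mul_comm]
  exact ((fderiv ℝ ψ y).le_opNorm _).trans (by gcongr; exact norm_horizontal_le w)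

theorem IsTest.integrable_norm_mul_norm_fderiv (hψ : IsTest ψ)
    (hu : MemLp (fun q : ℝ × Space3 => u q.1 q.2) 2 (cylMeasure ℓ T)) :
    Integrable (fun q : ℝ × Space3 => ‖u q.1 q.2‖ * ‖fderiv ℝ ψ q.2.1‖) (cylMeasure ℓ T) :=
  hu.norm.integrable_mul (memLp_comp_fst_cyl (hψ.memLp_fderiv 2)).norm

theorem IsTest.integrable_mul_fderiv_horizontal (hψ : IsTest ψ)
    (hb : MemLp (fun q : ℝ × Space3 => b q.1 q.2) ⊤ (cylMeasure ℓ T))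
    (hu : MemLp (fun q : ℝ × Space3 => u q.1 q.2) 2 (cylMeasure ℓ T)) :
    Integrable (fun q : ℝ × Space3 => b q.1 q.2 * fderiv ℝ ψ q.2.1 (horizontal (u q.1 q.2)))
      (cylMeasure ℓ T) := by
  have hmeas : AEStronglyMeasurable
      (fun q : ℝ × Space3 => fderiv ℝ ψ q.2.1 (horizontal (u q.1 q.2))) (cylMeasure ℓ T) :=
    (ContinuousLinearMap.id ℝ (Plane →L[ℝ] ℝ)).aestronglyMeasurable_comp₂
      (memLp_comp_fst_cyl (hψ.memLp_fderiv 2)).1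
      (continuous_horizontal.comp_aestronglyMeasurable hu.1)
  exact ((hψ.integrable_norm_mul_norm_fderiv hu).mono' hmeas
    (.of_forall fun q => norm_fderiv_horizontal_le ψ _ _)).smul_of_top_right hb

theorem IsTest.integrable_mul_cyl (hψ : IsTest ψ)
    (hb : MemLp (fun q : ℝ × Space3 => b q.1 q.2) ⊤ (cylMeasure ℓ T)) :
    Integrable (fun q : ℝ × Space3 => b q.1 q.2 * ψ q.2.1) (cylMeasure ℓ T) :=
  (memLp_one_iff_integrable.1 (memLp_comp_fst_cyl (hψ.memLp 1))).smul_of_top_right hb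

theorem IsC1b.memLp_top_comp (hβ : IsC1b β)
    (hρ : AEStronglyMeasurable (fun q : ℝ × Space3 => ρ q.1 q.2) (cylMeasure ℓ T)) :
    MemLp (fun q : ℝ × Space3 => β (ρ q.1 q.2)) ⊤ (cylMeasure ℓ T) :=
  let ⟨hβ1, C, hC⟩ := hβ
  memLp_top_of_bound (hβ1.continuous.comp_aestronglyMeasurable hρ) C (.of_forall fun _ => (hC _).1)

theorem SolvesMass.ae_balance (h : SolvesMass ℓ ρin ρ u)
    (hρ : AEStronglyMeasurable (fun q : ℝ × Space3 => ρ q.1 q.2) (cylMeasure ℓ T))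
    (hu : MemLp (fun q : ℝ × Space3 => u q.1 q.2) 2 (cylMeasure ℓ T))
    (hβ : IsC1b β) (hψ : IsTest ψ) (hT : 0 < T) :
    ∀ᵐ t ∂volume.restrict (Ioo 0 T), ∫ x, β (ρ t x) * ψ x.1 ∂slabMeasure ℓ
      = (∫ x, β (ρin x) * ψ x.1 ∂slabMeasure ℓ)
        + ∫ s in Ioc 0 t, horizontalFlux ℓ (fun t x => β (ρ t x)) u ψ s := by
  have hA := hψ.integrable_mul_cyl (b := fun t x => β (ρ t x)) (hβ.memLp_top_comp hρ)
  have hH := hψ.integrable_mul_fderiv_horizontal (b := fun t x => β (ρ t x))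
    (hβ.memLp_top_comp hρ) hu
  rw [cylMeasure_eq_prod] at hA hH
  refine ae_eq_add_primitive hT hA.integral_prod_left hH.integral_prod_left fun θ hθ hθT => ?_
  have hθ0 : ∀ t ∉ Iio T, θ t = 0 := fun t ht =>
    image_eq_zero_of_notMem_tsupport fun hm => ht (hθT hm)
  have hθ0' : ∀ t ∉ Iio T, deriv θ t = 0 := fun t ht =>
    image_eq_zero_of_notMem_tsupport fun hm => ht (hθT (tsupport_deriv_subset hm))
  rw [smul_eq_mul, ← h.integral_tensor hβ hθ hψ,
    setIntegral_eq_of_subset_of_forall_sdiff_eq_zero measurableSet_Ioi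
      (Ioo_subset_Ioi_self : Ioo 0 T ⊆ Ioi 0) fun t ht => by
        have htT : t ∉ Iio T := fun hlt => ht.2 ⟨ht.1, hlt⟩
        simp [hθ0 t htT, hθ0' t htT]]
  refine integral_congr_ae ?_
  filter_upwards [hA.prod_right_ae, hH.prod_right_ae] with t hAt hHt
  rw [smul_eq_mul, smul_eq_mul, horizontalFlux, ← integral_const_mul, ← integral_const_mul,
    ← integral_add (hAt.const_mul _) (hHt.const_mul _)]
  congr 1 with x
  ring

theorem abs_integral_horizontalFlux_le
    (hb : IsBetween M (fun q : ℝ × Space3 => b q.1 q.2) (cylMeasure ℓ T))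
    (hu : MemLp (fun q : ℝ × Space3 => u q.1 q.2) 2 (cylMeasure ℓ T)) (hψ : IsTest ψ)
    {t : ℝ} (ht : t ≤ T) :
    |∫ s in Ioc 0 t, horizontalFlux ℓ b u ψ s|
      ≤ M * ∫ q, ‖u q.1 q.2‖ * ‖fderiv ℝ ψ q.2.1‖ ∂cylMeasure ℓ T := by
  have hle : cylMeasure ℓ t ≤ cylMeasure ℓ T :=
    Measure.restrict_mono (prod_mono (Ioo_subset_Ioo_right ht) le_rfl) le_rfl
  have hflux := hψ.integrable_mul_fderiv_horizontal hb.memLp_top hu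
  have hint := hψ.integrable_norm_mul_norm_fderiv hu
  have hfub : ∫ s in Ioc 0 t, horizontalFlux ℓ b u ψ s
      = ∫ q, b q.1 q.2 * fderiv ℝ ψ q.2.1 (horizontal (u q.1 q.2)) ∂cylMeasure ℓ t := by
    have := hflux.mono_measure hle
    rw [cylMeasure_eq_prod] at this ⊢
    rw [integral_prod _ this, integral_Ioc_eq_integral_Ioo]
    rfl
  rw [hfub, ← integral_const_mul]
  calc _ ≤ ∫ q, ‖b q.1 q.2 * fderiv ℝ ψ q.2.1 (horizontal (u q.1 q.2))‖ ∂cylMeasure ℓ t :=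
        norm_integral_le_integral_norm _
    _ ≤ ∫ q, ‖b q.1 q.2 * fderiv ℝ ψ q.2.1 (horizontal (u q.1 q.2))‖ ∂cylMeasure ℓ T :=
        integral_mono_measure hle (.of_forall fun _ => norm_nonneg _) hflux.norm
    _ ≤ ∫ q, M * (‖u q.1 q.2‖ * ‖fderiv ℝ ψ q.2.1‖) ∂cylMeasure ℓ T := by
        refine integral_mono_ae hflux.norm (hint.const_mul M) ?_
        filter_upwards [hb.ae_abs_le] with q hq
        rw [norm_mul]
        exact mul_le_mul hq (norm_fderiv_horizontal_le _ _ _) (norm_nonneg _)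
          ((abs_nonneg _).trans hq)

end MassBalance

section EscapingSupport

variable {X F G : Type*} [MeasurableSpace X] {μ : Measure X} [NormedAddCommGroup F]
  [NormedAddCommGroup G]

theorem tendsto_integral_norm_mul_of_eventually_eq_zero {v : X → F} (hv : MemLp v 2 μ)
    {g : ℕ → X → G} {C : ℝ} (hg_meas : ∀ n, StronglyMeasurable (g n)) (hg : ∀ n, MemLp (g n) 2 μ)
    (hC : ∀ n, ∫ x, ‖g n x‖ ^ 2 ∂μ ≤ C) (hg0 : ∀ x, ∀ᶠ n in atTop, g n x = 0) :
    Tendsto (fun n => ∫ x, ‖v x‖ * ‖g n x‖ ∂μ) atTop (𝓝 0) := by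
  set w : ℕ → X → ℝ := fun n => (Function.support (g n)).indicator fun x => ‖v x‖
  have hw : ∀ n, MemLp (w n) 2 μ := fun n => hv.norm.indicator (hg_meas n).measurableSet_support
  have hwv : ∀ n x, ‖w n x‖ ≤ ‖v x‖ := fun n x => by
    simpa only [norm_norm] using norm_indicator_le_norm_self (fun x => ‖v x‖) x
  have hwg : ∀ n x, ‖w n x‖ * ‖g n x‖ = ‖v x‖ * ‖g n x‖ := fun n x => by
    by_cases hx : g n x = 0
    · simp [hx]
    · have : w n x = ‖v x‖ := indicator_of_mem (Function.mem_support.2 hx) _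
      rw [this, norm_norm]
  have hlim : Tendsto (fun n => ∫ x, ‖w n x‖ ^ 2 ∂μ) atTop (𝓝 (∫ _, (0 : ℝ) ∂μ)) := by
    refine tendsto_integral_of_dominated_convergence _ (fun n => (hw n).1.norm.pow 2)
      (hv.integrable_norm_pow two_ne_zero) (fun n => .of_forall fun x => ?_)
      (.of_forall fun x => tendsto_const_nhds.congr' ?_)
    · rw [norm_pow, norm_norm]
      gcongr
      exact hwv n x
    · filter_upwards [hg0 x] with n hn
      have : w n x = 0 := indicator_of_notMem (Function.notMem_support.2 hn) _
      simp [this]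
  have hbound : ∀ n, ∫ x, ‖v x‖ * ‖g n x‖ ∂μ ≤ √(∫ x, ‖w n x‖ ^ 2 ∂μ) * √C := fun n => by
    have h := integral_norm_mul_norm_le_sqrt (hw n) (hg n).norm
    simp only [norm_norm, hwg] at h
    exact h.trans (by gcongr; exact hC n)
  refine squeeze_zero (fun n => integral_nonneg fun x => by positivity) hbound ?_
  simpa using (Real.continuous_sqrt.tendsto _ |>.comp hlim).mul_const (√C)

theorem ae_eq_zero_of_tendsto_integral_mul {f : X → ℝ} {ψ : ℕ → X → ℝ}
    (hf_meas : AEStronglyMeasurable f μ) (hf : ∀ x, 0 ≤ f x) (hψ : ∀ n x, 0 ≤ ψ n x)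
    (hψ1 : ∀ x, ∀ᶠ n in atTop, ψ n x = 1) (hint : ∀ n, Integrable (fun x => f x * ψ n x) μ)
    (hlim : Tendsto (fun n => ∫ x, f x * ψ n x ∂μ) atTop (𝓝 0)) : f =ᵐ[μ] 0 := by
  have hliminf : ∀ x, ENNReal.ofReal (f x)
      = liminf (fun n => ENNReal.ofReal (f x * ψ n x)) atTop := fun x =>
    (Tendsto.liminf_eq (tendsto_const_nhds.congr' ((hψ1 x).mono fun n hn => by
      rw [hn, mul_one]))).symm
  have hlim' : Tendsto (fun n => ∫⁻ x, ENNReal.ofReal (f x * ψ n x) ∂μ) atTop (𝓝 0) := by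
    simpa only [ENNReal.ofReal_zero, ofReal_integral_eq_lintegral_ofReal (hint _)
      (.of_forall fun x => mul_nonneg (hf x) (hψ _ x))] using ENNReal.tendsto_ofReal hlim
  have hzero : ∫⁻ x, ENNReal.ofReal (f x) ∂μ ≤ 0 := by
    simp only [hliminf]
    exact (lintegral_liminf_le' fun n => (hint n).1.aemeasurable.ennreal_ofReal).trans_eq
      hlim'.liminf_eq
  filter_upwards [(lintegral_eq_zero_iff' hf_meas.aemeasurable.ennreal_ofReal).1
    (nonpos_iff_eq_zero.1 hzero)] with x hx
  exact le_antisymm (ENNReal.ofReal_eq_zero.1 hx) (hf x)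

end EscapingSupport

section MaximumPrinciple

theorem exists_cutoff_seq : ∃ (ψ : ℕ → Plane → ℝ) (C : ℝ), (∀ n, IsTest (ψ n)) ∧
    (∀ n y, 0 ≤ ψ n y) ∧ (∀ y, ∀ᶠ n in atTop, ψ n =ᶠ[𝓝 y] 1) ∧
    ∀ n, ∫ y, ‖fderiv ℝ (ψ n) y‖ ^ 2 ≤ C := by
  obtain ⟨κ, hκ, hκ0, hκ1⟩ := exists_isTest_eq_one (X := Plane) 1
  have hpos : ∀ n : ℕ, (0 : ℝ) < n + 1 := fun n => n.cast_add_one_pos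
  refine ⟨fun n y => κ ((n + 1 : ℝ)⁻¹ • y), ∫ y, ‖fderiv ℝ κ y‖ ^ 2, fun n =>
    ⟨hκ.1.comp (contDiff_const_smul _), hκ.2.comp_smul (inv_ne_zero (hpos n).ne')⟩,
    fun n y => hκ0 _, fun y => ?_, fun n => le_of_eq ?_⟩
  · obtain ⟨N, hN⟩ := exists_nat_gt ‖y‖
    filter_upwards [eventually_ge_atTop N] with n hn
    filter_upwards [(continuous_norm.tendsto y).eventually_lt_const hN] with z hz
    refine hκ1 _ ?_
    rw [norm_smul, Real.norm_of_nonneg (inv_nonneg.2 (hpos n).le), inv_mul_le_one₀ (hpos n)]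
    exact hz.le.trans ((Nat.cast_le.2 hn).trans (lt_add_one _).le)
  · -- the gradient is scale-invariant in `L²` precisely in dimension two
    simp only [fderiv_comp_smul, norm_smul, mul_pow]
    rw [integral_const_mul,
      Measure.integral_comp_inv_smul volume (fun y => ‖fderiv ℝ κ y‖ ^ 2)]
    simp [abs_of_pos (hpos n), (hpos n).ne']

theorem isC1b_of_deriv_hasCompactSupport {β : ℝ → ℝ} (hβ : ContDiff ℝ 1 β)
    (hβ' : HasCompactSupport (deriv β)) {C : ℝ} (hC : ∀ s, |β s| ≤ C) : IsC1b β := by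
  obtain ⟨C', hC'⟩ := hβ'.exists_bound_of_continuous (hβ.continuous_deriv le_rfl)
  exact ⟨hβ, max C C', fun s =>
    ⟨(hC s).trans (le_max_left _ _), (hC' s).trans (le_max_right _ _)⟩⟩

theorem exists_isC1b_eq_id (M : ℝ) : ∃ β : ℝ → ℝ, IsC1b β ∧ ∀ s, 0 ≤ s → s ≤ M → β s = s := by
  obtain ⟨κ, hκ, -, hκ1⟩ := exists_isTest_eq_one (X := ℝ) M
  have hs : ContDiff ℝ 1 (fun s => κ s * s) := (hκ.1.of_le (by simp)).mul contDiff_id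
  have hc : HasCompactSupport (fun s => κ s * s) := hκ.2.mul_right
  obtain ⟨C, hC⟩ := hc.exists_bound_of_continuous hs.continuous
  refine ⟨_, isC1b_of_deriv_hasCompactSupport hs hc.deriv hC, fun s h0 hM => ?_⟩
  rw [hκ1 s (by rwa [Real.norm_of_nonneg h0]), one_mul]

theorem isC1b_smoothTransition_sub (M : ℝ) : IsC1b (fun s => Real.smoothTransition (s - M)) := by
  refine isC1b_of_deriv_hasCompactSupport (C := 1)
    (Real.smoothTransition.contDiff.comp (contDiff_id.sub contDiff_const))
    (HasCompactSupport.intro (isCompact_Icc (a := M) (b := M + 1)) fun s hs => ?_) fun s => ?_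
  · rcases not_and_or.1 hs with hs | hs
    · have : (fun s => Real.smoothTransition (s - M)) =ᶠ[𝓝 s] fun _ => 0 := by
        filter_upwards [Iio_mem_nhds (not_le.1 hs)] with r hr
        exact Real.smoothTransition.zero_of_nonpos (sub_nonpos.2 (le_of_lt hr))
      rw [this.deriv_eq, deriv_const]
    · have : (fun s => Real.smoothTransition (s - M)) =ᶠ[𝓝 s] fun _ => 1 := by
        filter_upwards [Ioi_mem_nhds (not_le.1 hs)] with r hr
        exact Real.smoothTransition.one_of_one_le (le_sub_iff_add_le'.2 (le_of_lt hr))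
      rw [this.deriv_eq, deriv_const]
  · rw [abs_of_nonneg (Real.smoothTransition.nonneg _)]
    exact Real.smoothTransition.le_one _

variable {ℓ α e T M : ℝ} {ρin : Space3 → ℝ} {ρ : ℝ → Space3 → ℝ}
  {u : ℝ → Space3 → Vec3} {β : ℝ → ℝ} {ψ : Plane → ℝ}

theorem SolvesMass.integral_renormalized_le (h : SolvesMass ℓ ρin ρ u)
    (hρ : AEStronglyMeasurable (fun q : ℝ × Space3 => ρ q.1 q.2) (cylMeasure ℓ T))
    (hu : MemLp (fun q : ℝ × Space3 => u q.1 q.2) 2 (cylMeasure ℓ T))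
    (hβ : IsC1b β) (hβ1 : ∀ s, 0 ≤ β s ∧ β s ≤ 1) (hin : ∀ᵐ x ∂slabMeasure ℓ, β (ρin x) = 0)
    (hψ : IsTest ψ) (hT : 0 < T) :
    ∫ q, β (ρ q.1 q.2) * ψ q.2.1 ∂cylMeasure ℓ T
      ≤ T * ∫ q, ‖u q.1 q.2‖ * ‖fderiv ℝ ψ q.2.1‖ ∂cylMeasure ℓ T := by
  have hb : IsBetween 1 (fun q : ℝ × Space3 => β (ρ q.1 q.2)) (cylMeasure ℓ T) :=
    ⟨hβ.1.continuous.comp_aestronglyMeasurable hρ, .of_forall fun _ => hβ1 _⟩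
  have hint := hψ.integrable_mul_cyl (b := fun t x => β (ρ t x)) hb.memLp_top
  have hin0 : ∫ x, β (ρin x) * ψ x.1 ∂slabMeasure ℓ = 0 :=
    integral_eq_zero_of_ae (hin.mono fun x hx => by simp [hx])
  set R := ∫ q, ‖u q.1 q.2‖ * ‖fderiv ℝ ψ q.2.1‖ ∂cylMeasure ℓ T
  have hle : ∀ᵐ t ∂volume.restrict (Ioo 0 T), ∫ x, β (ρ t x) * ψ x.1 ∂slabMeasure ℓ ≤ R := by
    filter_upwards [h.ae_balance hρ hu hβ hψ hT, ae_restrict_mem measurableSet_Ioo] with t hbal ht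
    rw [hbal, hin0, zero_add, ← one_mul R]
    exact (le_abs_self _).trans
      (abs_integral_horizontalFlux_le (b := fun t x => β (ρ t x)) hb hu hψ ht.2.le)
  rw [cylMeasure_eq_prod] at hint ⊢
  rw [integral_prod _ hint]
  refine (integral_mono_ae hint.integral_prod_left (integrable_const R) hle).trans_eq ?_
  rw [integral_const, measureReal_restrict_apply_univ, Real.volume_real_Ioo_of_le hT.le, sub_zero,
    smul_eq_mul]

theorem integral_comp_fst_cyl (hℓ : 0 < ℓ) (hT : 0 ≤ T) (g : Plane → ℝ) :
    ∫ q, g q.2.1 ∂cylMeasure ℓ T = T * (2 * ℓ) * ∫ y, g y := by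
  rw [cylMeasure_eq_prod, slabMeasure_eq_prod, integral_fun_snd (f := fun x : Space3 => g x.1),
    integral_fun_fst (f := g), measureReal_restrict_Ioo_neg hℓ, measureReal_restrict_apply_univ,
    Real.volume_real_Ioo_of_le hT]
  simp only [sub_zero, smul_eq_mul, mul_assoc]

theorem SolvesMass.ae_le (hℓ : 0 < ℓ) (h : SolvesMass ℓ ρin ρ u)
    (hρ : AEStronglyMeasurable (fun q : ℝ × Space3 => ρ q.1 q.2) (cylMeasure ℓ T))
    (hu : MemLp (fun q : ℝ × Space3 => u q.1 q.2) 2 (cylMeasure ℓ T))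
    (hρin : ∀ᵐ x ∂slabMeasure ℓ, ρin x ≤ M) (hT : 0 < T) :
    ∀ᵐ q ∂cylMeasure ℓ T, ρ q.1 q.2 ≤ M := by
  obtain ⟨ψ, C, hψ, hψ_nonneg, hψ1, hψC⟩ := exists_cutoff_seq
  set β : ℝ → ℝ := fun s => Real.smoothTransition (s - M)
  have hβ : IsC1b β := isC1b_smoothTransition_sub M
  have hβ01 : ∀ s, 0 ≤ β s ∧ β s ≤ 1 := fun s =>
    ⟨Real.smoothTransition.nonneg _, Real.smoothTransition.le_one _⟩
  have hβin : ∀ᵐ x ∂slabMeasure ℓ, β (ρin x) = 0 := hρin.mono fun x hx =>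
    Real.smoothTransition.zero_of_nonpos (sub_nonpos.2 hx)
  have hflux : Tendsto (fun n => T * ∫ q, ‖u q.1 q.2‖ * ‖fderiv ℝ (ψ n) q.2.1‖ ∂cylMeasure ℓ T)
      atTop (𝓝 0) := by
    rw [← mul_zero T]
    refine (tendsto_integral_norm_mul_of_eventually_eq_zero (C := T * (2 * ℓ) * C)
      hu (g := fun n q => fderiv ℝ (ψ n) q.2.1) (fun n => ?_)
      (fun n => memLp_comp_fst_cyl ((hψ n).memLp_fderiv 2)) (fun n => ?_) fun q => ?_).const_mul T
    · exact (((hψ n).1.continuous_fderiv (by simp)).comp (by fun_prop)).stronglyMeasurable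
    · rw [integral_comp_fst_cyl hℓ hT.le fun y => ‖fderiv ℝ (ψ n) y‖ ^ 2]
      gcongr
      exact hψC n
    · filter_upwards [hψ1 q.2.1] with n hn
      rw [hn.fderiv_eq, Pi.one_def, fderiv_fun_const, Pi.zero_apply]
  have hβ0 : (fun q : ℝ × Space3 => β (ρ q.1 q.2)) =ᵐ[cylMeasure ℓ T] 0 := by
    refine ae_eq_zero_of_tendsto_integral_mul (ψ := fun n q => ψ n q.2.1)
      (hβ.memLp_top_comp hρ).1 (fun q => (hβ01 _).1) (fun n q => hψ_nonneg n _)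
      (fun q => (hψ1 q.2.1).mono fun n hn => hn.eq_of_nhds)
      (fun n => (hψ n).integrable_mul_cyl (b := fun t x => β (ρ t x)) (hβ.memLp_top_comp hρ))
      (squeeze_zero (fun n => integral_nonneg fun q => mul_nonneg (hβ01 _).1 (hψ_nonneg n _))
        (fun n => h.integral_renormalized_le hρ hu hβ hβ01 hβin (hψ n) hT) hflux)
  filter_upwards [hβ0] with q hq
  by_contra hM
  exact (Real.smoothTransition.pos_of_pos (sub_pos.2 (not_le.1 hM))).ne' hq

theorem IsFiniteEnergyTransport.isBetween (h : IsFiniteEnergyTransport ℓ α e ρin ρ u) (hℓ : 0 < ℓ)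
    (hρin : IsBetween M ρin (slabMeasure ℓ)) (hT : 0 < T) :
    IsBetween M (fun q : ℝ × Space3 => ρ q.1 q.2) (cylMeasure ℓ T) := by
  refine ⟨(h.memLp T hT).1, ?_⟩
  filter_upwards [h.nonneg T hT, h.solvesMass.ae_le hℓ (h.memLp T hT).1 (h.memLp_velocity hT)
    (hρin.2.mono fun x hx => hx.2) hT] with q h0 hM using ⟨h0, hM⟩

end MaximumPrinciple

section Representative

variable {ℓ α e T M : ℝ} {ρin : Space3 → ℝ} {ρ : ℝ → Space3 → ℝ}
  {u : ℝ → Space3 → Vec3} {ψ : Plane → ℝ}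

theorem IsFiniteEnergyTransport.ae_isBetween (h : IsFiniteEnergyTransport ℓ α e ρin ρ u)
    (hℓ : 0 < ℓ) (hρin : IsBetween M ρin (slabMeasure ℓ)) :
    ∀ᵐ t ∂volume.restrict (Ioi 0), IsBetween M (ρ t) (slabMeasure ℓ) := by
  refine ae_restrict_Ioi_of_forall_Ioo fun T hT => ?_
  have hρ := h.isBetween hℓ hρin hT
  rw [cylMeasure_eq_prod] at hρ
  exact hρ.ae_prodMk_left

theorem IsFiniteEnergyTransport.ae_balance (h : IsFiniteEnergyTransport ℓ α e ρin ρ u)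
    (hℓ : 0 < ℓ) (hρin : IsBetween M ρin (slabMeasure ℓ)) (hψ : IsTest ψ) :
    ∀ᵐ t ∂volume.restrict (Ioi 0), ∫ y, vAvg ℓ (ρ t) y * ψ y
      = (∫ y, vAvg ℓ ρin y * ψ y) + (2 * ℓ)⁻¹ * ∫ s in Ioc 0 t, horizontalFlux ℓ ρ u ψ s := by
  obtain ⟨β, hβ, hβid⟩ := exists_isC1b_eq_id M
  have hβf : ∀ {f : Space3 → ℝ}, IsBetween M f (slabMeasure ℓ) →
      (fun x => β (f x)) =ᵐ[slabMeasure ℓ] f := fun hf =>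
    hf.2.mono fun x hx => hβid _ hx.1 hx.2
  have hβint : ∀ {f : Space3 → ℝ}, IsBetween M f (slabMeasure ℓ) →
      ∫ x, β (f x) * ψ x.1 ∂slabMeasure ℓ = 2 * ℓ * ∫ y, vAvg ℓ f y * ψ y := fun hf => by
    rw [← integral_slab_mul_comp_fst hℓ hf hψ.integrable]
    exact integral_congr_ae ((hβf hf).mul .rfl)
  have hρ := h.ae_isBetween hℓ hρin
  have hflux : horizontalFlux ℓ (fun t x => β (ρ t x)) u ψ
      =ᵐ[volume.restrict (Ioi 0)] horizontalFlux ℓ ρ u ψ :=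
    hρ.mono fun t ht => integral_congr_ae ((hβf ht).mul .rfl)
  have hbal : ∀ᵐ t ∂volume.restrict (Ioi 0), ∫ x, β (ρ t x) * ψ x.1 ∂slabMeasure ℓ
      = (∫ x, β (ρin x) * ψ x.1 ∂slabMeasure ℓ)
        + ∫ s in Ioc 0 t, horizontalFlux ℓ (fun t x => β (ρ t x)) u ψ s :=
    ae_restrict_Ioi_of_forall_Ioo fun T hT =>
      h.solvesMass.ae_balance (h.memLp T hT).1 (h.memLp_velocity hT) hβ hψ hT
  filter_upwards [hρ, hbal] with t hρt ht
  rw [hβint hρt, hβint hρin,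
    integral_congr_ae (ae_restrict_of_ae_restrict_of_subset Ioc_subset_Ioi_self hflux)] at ht
  field_simp
  linarith

theorem IsFiniteEnergyTransport.continuousOn_primitive_horizontalFlux
    (h : IsFiniteEnergyTransport ℓ α e ρin ρ u) (hψ : IsTest ψ) :
    ContinuousOn (fun t => ∫ s in Ioc 0 t, horizontalFlux ℓ ρ u ψ s) (Ici 0) := by
  intro t (ht : 0 ≤ t)
  have hT : 0 < t + 1 := by positivity
  have hflux := hψ.integrable_mul_fderiv_horizontal (h.memLp _ hT) (h.memLp_velocity hT)
  rw [cylMeasure_eq_prod] at hflux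
  have hcont := continuousOn_primitive_Icc hflux.integral_prod_left t ⟨ht, by simp⟩
  exact hcont.mono_of_mem_nhdsWithin (mem_of_superset
    (inter_mem_nhdsWithin _ (Iio_mem_nhds (lt_add_one t))) fun s hs => ⟨hs.1, le_of_lt hs.2⟩)

theorem abs_integral_horizontalFlux_le_meanVelocitySq (hℓ : 0 < ℓ) (hT : 0 < T)
    (hρ : IsBetween M (fun q : ℝ × Space3 => ρ q.1 q.2) (cylMeasure ℓ T)) (hM : 0 ≤ M)
    (hu : MemLp (fun q : ℝ × Space3 => u q.1 q.2) 2 (cylMeasure ℓ T)) (hψ : IsTest ψ)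
    {t : ℝ} (ht : t ≤ T) :
    |(2 * ℓ)⁻¹ * ∫ s in Ioc 0 t, horizontalFlux ℓ ρ u ψ s|
      ≤ M * (√(meanVelocitySq ℓ T u) * √(T * ∫ y, ‖fderiv ℝ ψ y‖ ^ 2)) := by
  have hcs := integral_norm_mul_norm_le_sqrt hu.norm
    (memLp_comp_fst_cyl (ℓ := ℓ) (T := T) (hψ.memLp_fderiv 2)).norm
  simp only [norm_norm] at hcs
  rw [integral_comp_fst_cyl hℓ hT.le fun y => ‖fderiv ℝ ψ y‖ ^ 2] at hcs
  rw [abs_mul, abs_of_pos (by positivity : 0 < (2 * ℓ)⁻¹), inv_mul_le_iff₀ (by positivity)]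
  have hℓ2 : 0 ≤ 2 * ℓ := by positivity
  calc _ ≤ M * ∫ q, ‖u q.1 q.2‖ * ‖fderiv ℝ ψ q.2.1‖ ∂cylMeasure ℓ T :=
        abs_integral_horizontalFlux_le hρ hu hψ ht
    _ ≤ M * (√(∫ q, ‖u q.1 q.2‖ ^ 2 ∂cylMeasure ℓ T)
          * √(T * (2 * ℓ) * ∫ y, ‖fderiv ℝ ψ y‖ ^ 2)) := by gcongr
    _ = M * (√(2 * ℓ * meanVelocitySq ℓ T u) * √(2 * ℓ * (T * ∫ y, ‖fderiv ℝ ψ y‖ ^ 2))) := by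
        rw [meanVelocitySq, mul_inv_cancel_left₀ (by positivity)]
        ring_nf
    _ = √(2 * ℓ) * √(2 * ℓ)
          * (M * (√(meanVelocitySq ℓ T u) * √(T * ∫ y, ‖fderiv ℝ ψ y‖ ^ 2))) := by
        rw [Real.sqrt_mul hℓ2, Real.sqrt_mul hℓ2]
        ring
    _ = _ := by rw [Real.mul_self_sqrt hℓ2]

theorem IsFiniteEnergyTransport.exists_representative
    (h : IsFiniteEnergyTransport ℓ α e ρin ρ u) (hℓ : 0 < ℓ)
    (hρin : IsBetween M ρin (slabMeasure ℓ)) :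
    ∃ F : ℝ → Plane → ℝ, (∀ t, 0 ≤ t → IsBetween M (F t) volume) ∧
      (∀ᵐ t ∂volume.restrict (Ioi 0), F t =ᵐ[volume] vAvg ℓ (ρ t)) ∧
      (∀ g, Integrable g → ContinuousOn (fun t => ∫ y, F t y * g y) (Ici 0)) ∧
      ∀ T, 0 < T → ∀ t ∈ Icc 0 T, ∀ ψ, IsTest ψ →
        |(∫ y, F t y * ψ y) - ∫ y, vAvg ℓ ρin y * ψ y|
          ≤ M * (√(meanVelocitySq ℓ T u) * √(T * ∫ y, ‖fderiv ℝ ψ y‖ ^ 2)) := by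
  have hM : 0 ≤ M := (isBetween_vAvg hℓ hρin).nonneg
  have hIci : (volume : Measure ℝ).restrict (Ici 0) = volume.restrict (Ioi 0) :=
    (Measure.restrict_congr_set Ioi_ae_eq_Ici).symm
  have hclosure : Ici (0 : ℝ) ⊆ closure (interior (Ici 0)) := by simp
  let A (ψ : Plane → ℝ) (t : ℝ) : ℝ :=
    (∫ y, vAvg ℓ ρin y * ψ y) + (2 * ℓ)⁻¹ * ∫ s in Ioc 0 t, horizontalFlux ℓ ρ u ψ s
  have hA : ∀ ψ, IsTest ψ → ContinuousOn (A ψ) (Ici 0) := fun ψ hψ =>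
    continuousOn_const.add (continuousOn_const.mul (h.continuousOn_primitive_horizontalFlux hψ))
  obtain ⟨F, hF, hFρ, hFcont⟩ := exists_weaklyContinuous_representative
    (ν := (volume : Measure ℝ)) (μ := (volume : Measure Plane)) (f := fun t => vAvg ℓ (ρ t)) hM
    measurableSet_Ici hclosure
    (hIci ▸ (h.ae_isBetween hℓ hρin).mono fun t ht => isBetween_vAvg hℓ ht)
    fun ψ hψ => ⟨A ψ, hA ψ hψ, hIci ▸ h.ae_balance hℓ hρin hψ⟩
  refine ⟨F, hF, hIci ▸ hFρ, hFcont, fun T hT t ht ψ hψ => ?_⟩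
  have hFA : EqOn (fun t => ∫ y, F t y * ψ y) (A ψ) (Ici 0) := by
    refine Measure.eqOn_of_ae_eq (μ := (volume : Measure ℝ)) ?_ (hFcont ψ hψ.integrable) (hA ψ hψ)
      hclosure
    rw [hIci] at hFρ ⊢
    filter_upwards [hFρ, h.ae_balance hℓ hρin hψ] with t hFt hbal
    exact (integral_congr_ae (hFt.mul .rfl)).trans hbal
  have hFt : ∫ y, F t y * ψ y = A ψ t := hFA ht.1
  rw [hFt, add_sub_cancel_left]
  exact abs_integral_horizontalFlux_le_meanVelocitySq hℓ hT (h.isBetween hℓ hρin hT) hM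
    (h.memLp_velocity hT) hψ ht.2

end Representative

section Convergence

variable {ι Y X : Type*} [MeasurableSpace X] {μ : Measure X} {l : Filter ι} {M : ℝ}
  {F : ι → Y → X → ℝ} {f₀ : X → ℝ}

theorem tendstoUniformlyOn_const_of_abs_sub_le {A : ι → Y → ℝ} {a e : ι → ℝ} {b : ℝ} {S : Set Y}
    (hA : ∀ᶠ i in l, ∀ t ∈ S, |A i t - a i| ≤ e i) (he : Tendsto e l (𝓝 0))
    (ha : Tendsto a l (𝓝 b)) : TendstoUniformlyOn A (fun _ => b) l S := by
  refine Metric.tendstoUniformlyOn_iff.2 fun δ hδ => ?_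
  have hsum : Tendsto (fun i => e i + |a i - b|) l (𝓝 0) := by
    simpa using he.add (ha.sub_const b).abs
  filter_upwards [hA, hsum.eventually_lt_const hδ] with i hi hlt t ht
  rw [dist_comm, Real.dist_eq]
  exact ((abs_sub_le _ (a i) _).trans (add_le_add_left (hi t ht) _)).trans_lt hlt

theorem tendstoUniformlyOn_integral_mul_of_isTest {X : Type*} [NormedAddCommGroup X]
    [NormedSpace ℝ X] [FiniteDimensional ℝ X] [MeasurableSpace X] [BorelSpace X] {μ : Measure X}
    [IsFiniteMeasureOnCompacts μ] {F : ι → Y → X → ℝ} {f₀ : X → ℝ} {S : Set Y} (hM : 0 ≤ M)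
    (hF : ∀ᶠ i in l, ∀ t ∈ S, IsBetween M (F i t) μ) (hf₀ : IsBetween M f₀ μ)
    (htest : ∀ ψ, IsTest ψ → TendstoUniformlyOn (fun i t => ∫ x, F i t x * ψ x ∂μ)
      (fun _ => ∫ x, f₀ x * ψ x ∂μ) l S)
    {g : X → ℝ} (hg : Integrable g μ) :
    TendstoUniformlyOn (fun i t => ∫ x, F i t x * g x ∂μ) (fun _ => ∫ x, f₀ x * g x ∂μ) l S := by
  refine Metric.tendstoUniformlyOn_iff.2 fun δ hδ => ?_
  obtain ⟨ψ, hψ, hgψ⟩ := exists_isTest_integral_abs_sub_le hg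
    (by positivity : 0 < δ / (3 * (M + 1)))
  have hMψ : M * ∫ x, |g x - ψ x| ∂μ < δ / 3 := by
    calc M * ∫ x, |g x - ψ x| ∂μ ≤ M * (δ / (3 * (M + 1))) := by gcongr
      _ < (M + 1) * (δ / (3 * (M + 1))) := by gcongr; exact lt_add_one M
      _ = δ / 3 := by field_simp
  filter_upwards [hF, Metric.tendstoUniformlyOn_iff.1 (htest ψ hψ) (δ / 3) (by positivity)]
    with i hFi hψi t ht
  have hFg := (hFi t ht).abs_integral_mul_sub_le hg hψ.integrable
  have hf₀g := hf₀.abs_integral_mul_sub_le hg hψ.integrable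
  have hFf₀ := hψi t ht
  rw [Real.dist_eq, abs_lt] at hFf₀ ⊢
  rw [abs_le] at hFg hf₀g
  constructor <;> linarith

theorem tendsto_integral_prod_mul [MeasurableSpace Y] {ν : Measure Y} [SFinite ν] [SFinite μ]
    [l.IsCountablyGenerated] {f : ι → Y × X → ℝ} (hf : ∀ᶠ i in l, IsBetween M (f i) (ν.prod μ))
    (hf₀ : IsBetween M f₀ μ) (hF : ∀ᶠ i in l, ∀ᵐ t ∂ν, F i t =ᵐ[μ] fun x => f i (t, x))
    (hlim : ∀ᵐ t ∂ν, ∀ g, Integrable g μ →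
      Tendsto (fun i => ∫ x, F i t x * g x ∂μ) l (𝓝 (∫ x, f₀ x * g x ∂μ)))
    {φ : Y × X → ℝ} (hφ : Integrable φ (ν.prod μ)) :
    Tendsto (fun i => ∫ q, f i q * φ q ∂ν.prod μ) l (𝓝 (∫ q, f₀ q.2 * φ q ∂ν.prod μ)) := by
  have hf₀' : IsBetween M (fun q : Y × X => f₀ q.2) (ν.prod μ) :=
    ⟨hf₀.1.comp_snd, Measure.quasiMeasurePreserving_snd.ae hf₀.2⟩
  have hfφ : ∀ᶠ i in l, (fun t => ∫ x, f i (t, x) * φ (t, x) ∂μ)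
      =ᵐ[ν] fun t => ∫ x, F i t x * φ (t, x) ∂μ :=
    hF.mono fun i hFi => hFi.mono fun t ht => integral_congr_ae (ht.symm.mul .rfl)
  rw [integral_prod _ (hf₀'.integrable_mul hφ)]
  have hconv : Tendsto (fun i => ∫ t, ∫ x, F i t x * φ (t, x) ∂μ ∂ν) l
      (𝓝 (∫ t, ∫ x, f₀ x * φ (t, x) ∂μ ∂ν)) := by
    refine tendsto_integral_filter_of_dominated_convergence (fun t => M * ∫ x, |φ (t, x)| ∂μ)
      ?_ ?_ (hφ.abs.integral_prod_left.const_mul M) ?_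
    · filter_upwards [hf, hfφ] with i hfi hi
      exact (hfi.integrable_mul hφ).integral_prod_left.1.congr hi
    · filter_upwards [hf, hF] with i hfi hFi
      filter_upwards [hfi.ae_prodMk_left, hFi, hφ.prod_right_ae] with t hft hFt hφt
      exact (hft.congr hFt.symm).abs_integral_mul_le hφt
    · filter_upwards [hlim, hφ.prod_right_ae] with t ht hφt using ht _ hφt
  refine hconv.congr' ?_
  filter_upwards [hf, hfφ] with i hfi hi
  rw [integral_prod _ (hfi.integrable_mul hφ), integral_congr_ae hi]

theorem eLpNorm_two_eq_ofReal_sqrt {G : Type*} [NormedAddCommGroup G] {f : X → G}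
    (hf : MemLp f 2 μ) : eLpNorm f 2 μ = ENNReal.ofReal (√(∫ x, ‖f x‖ ^ 2 ∂μ)) := by
  rw [hf.eLpNorm_eq_integral_rpow_norm two_ne_zero ENNReal.ofNat_ne_top]
  simp [Real.sqrt_eq_rpow]

theorem tendstoCWeak_of_tendstoUniformlyOn {E : Set ℝ} {T : ℝ} {F : ℝ → ℝ → Plane → ℝ}
    {ρ0 : Plane → ℝ} (hF : ∀ ε ∈ E, ∀ t, 0 ≤ t → IsBetween M (F ε t) volume)
    (hcont : ∀ ε ∈ E, ∀ g, Integrable g → ContinuousOn (fun t => ∫ y, F ε t y * g y) (Ici 0))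
    (hlim : ∀ g, Integrable g → TendstoUniformlyOn (fun ε t => ∫ y, F ε t y * g y)
      (fun _ => ∫ y, ρ0 y * g y) (𝓝[E] 0) (Icc 0 T))
    {K : Set Plane} (hK : IsCompact K) (p : ℝ≥0∞) : TendstoCWeak E T K p F ρ0 := by
  have : IsFiniteMeasure ((volume : Measure Plane).restrict K) :=
    isFiniteMeasure_restrict.2 hK.measure_ne_top
  refine ⟨fun ε hε t ht => ((hF ε hε t ht.1).memLp_top.restrict K).mono_exponent le_top,
    fun q hpq φ hφ => ?_⟩
  have hφK : Integrable (K.indicator φ) :=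
    (integrable_indicator_iff hK.measurableSet).2 (hφ.integrable hpq.symm.le)
  have hpair : ∀ f : Plane → ℝ, ∫ y in K, f y * φ y = ∫ y, f y * K.indicator φ y := fun f => by
    rw [← integral_indicator hK.measurableSet]
    exact integral_congr_ae (.of_forall fun y => indicator_mul_right K f φ)
  simp only [hpair]
  exact ⟨fun ε hε => (hcont ε hε _ hφK).mono Icc_subset_Ici_self, hlim _ hφK⟩

end Convergence

theorem tendsto_eLpNorm_vAvg {E : Set ℝ} {ℓ : ℝ → ℝ} {u : ℝ → ℝ → Space3 → Vec3} {T : ℝ}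
    (hℓ_pos : ∀ ε ∈ E, 0 < ℓ ε)
    (hu : ∀ ε ∈ E, MemLp (fun q : ℝ × Space3 => u ε q.1 q.2) 2 (cylMeasure (ℓ ε) T))
    (hlim : Tendsto (fun ε => meanVelocitySq (ℓ ε) T (u ε)) (𝓝[E] 0) (𝓝 0)) :
    Tendsto (fun ε => eLpNorm (fun q : ℝ × Plane => vAvg (ℓ ε) (u ε q.1) q.2) 2
      (planeCylMeasure T)) (𝓝[E] 0) (𝓝 0) := by
  have hbound : Tendsto (fun ε => ENNReal.ofReal (√(meanVelocitySq (ℓ ε) T (u ε)))) (𝓝[E] 0)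
      (𝓝 0) := by
    simpa using ENNReal.tendsto_ofReal hlim.sqrt
  refine tendsto_of_tendsto_of_tendsto_of_le_of_le' tendsto_const_nhds hbound
    (.of_forall fun _ => bot_le) ?_
  filter_upwards [self_mem_nhdsWithin] with ε hε
  obtain ⟨hmem, hle⟩ := memLp_two_vAvg_cyl (hℓ_pos ε hε) (hu ε hε)
  rw [eLpNorm_two_eq_ofReal_sqrt hmem]
  exact ENNReal.ofReal_le_ofReal (Real.sqrt_le_sqrt hle)

theorem tendstoUniformlyOn_integral_representative {E : Set ℝ} {ℓ : ℝ → ℝ} {T M : ℝ}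
    {ρ0 : Plane → ℝ} {ρin : ℝ → Space3 → ℝ} {u : ℝ → ℝ → Space3 → Vec3} {F : ℝ → ℝ → Plane → ℝ}
    (hρ0 : IsBetween M ρ0 volume)
    (hlim : ∀ ψ, IsTest ψ → Tendsto (fun ε => ∫ y, vAvg (ℓ ε) (ρin ε) y * ψ y) (𝓝[E] 0)
      (𝓝 (∫ y, ρ0 y * ψ y)))
    (hu : Tendsto (fun ε => meanVelocitySq (ℓ ε) T (u ε)) (𝓝[E] 0) (𝓝 0))
    (hF : ∀ ε ∈ E, ∀ t, 0 ≤ t → IsBetween M (F ε t) volume)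
    (hF_init : ∀ ε ∈ E, ∀ t ∈ Icc 0 T, ∀ ψ, IsTest ψ →
      |(∫ y, F ε t y * ψ y) - ∫ y, vAvg (ℓ ε) (ρin ε) y * ψ y|
        ≤ M * (√(meanVelocitySq (ℓ ε) T (u ε)) * √(T * ∫ y, ‖fderiv ℝ ψ y‖ ^ 2)))
    {g : Plane → ℝ} (hg : Integrable g) :
    TendstoUniformlyOn (fun ε t => ∫ y, F ε t y * g y) (fun _ => ∫ y, ρ0 y * g y) (𝓝[E] 0)
      (Icc 0 T) := by
  refine tendstoUniformlyOn_integral_mul_of_isTest hρ0.nonneg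
    (eventually_mem_nhdsWithin.mono fun ε hε t ht => hF ε hε t ht.1) hρ0 (fun ψ hψ => ?_) hg
  refine tendstoUniformlyOn_const_of_abs_sub_le
    (eventually_mem_nhdsWithin.mono fun ε hε t ht => hF_init ε hε t ht ψ hψ) ?_ (hlim ψ hψ)
  simpa using (hu.sqrt.mul_const √(T * ∫ y, ‖fderiv ℝ ψ y‖ ^ 2)).const_mul M

section InitialData

variable {ℓ ε M C : ℝ} {ρ0 : Plane → ℝ} {rin : ℝ → Space3 → ℝ}

theorem ae_vAvg_initialDensity (hℓ : 0 < ℓ)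
    (h : IsBetween M (initialDensity ρ0 rin ε) (slabMeasure ℓ)) :
    ∀ᵐ y, vAvg ℓ (initialDensity ρ0 rin ε) y = ρ0 y + ε * vAvg ℓ (rin ε) y := by
  rw [slabMeasure_eq_prod] at h
  filter_upwards [h.ae_prodMk_left] with y hy
  have hrin : Integrable (fun z => ε * rin ε (y, z)) (volume.restrict (Ioo (-ℓ) ℓ)) := by
    exact ((hy.memLp_top.integrable le_top).sub (integrable_const (ρ0 y))).congr
      (.of_forall fun z => by simp [initialDensity])
  simp only [vAvg, initialDensity, smul_eq_mul]
  rw [integral_add (integrable_const _) hrin, integral_const_mul]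
  simp only [integral_const, measureReal_restrict_apply_univ, Real.volume_real_Ioo, smul_eq_mul]
  rw [sub_neg_eq_add, max_eq_left (by positivity)]
  field_simp
  ring

theorem abs_integral_vAvg_initialDensity_sub_le (hℓ : 0 < ℓ)
    (h : IsBetween M (initialDensity ρ0 rin ε) (slabMeasure ℓ)) (hρ0 : IsBetween M ρ0 volume)
    (hC : ∀ᵐ y, |vAvg ℓ (rin ε) y| ≤ C) {g : Plane → ℝ} (hg : Integrable g) :
    |(∫ y, vAvg ℓ (initialDensity ρ0 rin ε) y * g y) - ∫ y, ρ0 y * g y|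
      ≤ |ε| * (C * ∫ y, |g y|) := by
  have hsub : (∫ y, vAvg ℓ (initialDensity ρ0 rin ε) y * g y) - ∫ y, ρ0 y * g y
      = ε * ∫ y, vAvg ℓ (rin ε) y * g y := by
    rw [← integral_sub ((isBetween_vAvg hℓ h).integrable_mul hg) (hρ0.integrable_mul hg),
      ← integral_const_mul]
    refine integral_congr_ae ?_
    filter_upwards [ae_vAvg_initialDensity hℓ h] with y hy
    rw [hy]
    ring
  rw [hsub, abs_mul, ← integral_const_mul]
  gcongr
  refine norm_integral_le_of_norm_le (f := fun y => vAvg ℓ (rin ε) y * g y) (hg.abs.const_mul C) ?_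
  filter_upwards [hC] with y hy
  rw [norm_mul]
  exact mul_le_mul_of_nonneg_right hy (abs_nonneg _)

theorem InitialDataAssumptions.exists_isBetween {E : Set ℝ} {ℓ : ℝ → ℝ} {m : ℝ → Space3 → Vec3}
    (hdata : InitialDataAssumptions E ℓ ρ0 rin m) :
    ∃ M, IsBetween M ρ0 volume ∧
      ∀ ε ∈ E, IsBetween M (initialDensity ρ0 rin ε) (slabMeasure (ℓ ε)) := by
  obtain ⟨ρs, hρs, hρ0, hρin⟩ := hdata.density_bounds
  refine ⟨2 * ρs, ⟨hdata.profile_C2.continuous.aestronglyMeasurable, .of_forall fun y => ?_⟩,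
    fun ε hε => ⟨(hdata.density_memLp ε hε).1, hρin ε hε⟩⟩
  exact ⟨(hρ0 y).1, by linarith [(hρ0 y).2]⟩

theorem InitialDataAssumptions.tendsto_integral_vAvg {E : Set ℝ} {ℓ : ℝ → ℝ}
    {m : ℝ → Space3 → Vec3} (hdata : InitialDataAssumptions E ℓ ρ0 rin m)
    (hℓ_pos : ∀ ε ∈ E, 0 < ℓ ε) {g : Plane → ℝ} (hg : Integrable g) :
    Tendsto (fun ε => ∫ y, vAvg (ℓ ε) (initialDensity ρ0 rin ε) y * g y) (𝓝[E] 0)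
      (𝓝 (∫ y, ρ0 y * g y)) := by
  obtain ⟨M, hρ0, hρin⟩ := hdata.exists_isBetween
  obtain ⟨C, hC⟩ := hdata.perturbation_Linfty
  have hε : Tendsto (fun ε : ℝ => |ε| * (C * ∫ y, |g y|)) (𝓝[E] 0) (𝓝 0) := by
    refine Tendsto.mono_left ?_ nhdsWithin_le_nhds
    exact Continuous.tendsto' (by fun_prop) _ _ (by simp)
  exact tendsto_iff_norm_sub_tendsto_zero.2 (squeeze_zero'
    (.of_forall fun _ => norm_nonneg _) (eventually_mem_nhdsWithin.mono fun ε hε =>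
      abs_integral_vAvg_initialDensity_sub_le (hℓ_pos ε hε) (hρin ε hε) hρ0 (hC ε hε) hg) hε)

end InitialData

theorem tendstoWeakStar_of_tendsto_representative {E : Set ℝ} {T M : ℝ}
    {f F : ℝ → ℝ → Plane → ℝ} {ρ0 : Plane → ℝ} (hρ0 : IsBetween M ρ0 volume)
    (hf : ∀ ε ∈ E, IsBetween M (fun q : ℝ × Plane => f ε q.1 q.2) (planeCylMeasure T))
    (hF : ∀ ε ∈ E, ∀ᵐ t ∂volume.restrict (Ioi 0), F ε t =ᵐ[volume] f ε t)
    (hlim : ∀ t ∈ Icc 0 T, ∀ g, Integrable g →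
      Tendsto (fun ε => ∫ y, F ε t y * g y) (𝓝[E] 0) (𝓝 (∫ y, ρ0 y * g y))) :
    TendstoWeakStar E T f ρ0 := by
  refine ⟨fun ε hε => (hf ε hε).memLp_top, fun φ hφ => ?_⟩
  simp only [planeCylMeasure_eq_prod] at hf hφ ⊢
  refine tendsto_integral_prod_mul (eventually_mem_nhdsWithin.mono hf) hρ0
    (eventually_mem_nhdsWithin.mono fun ε hε =>
      ae_restrict_of_ae_restrict_of_subset Ioo_subset_Ioi_self (hF ε hε)) ?_ hφ
  filter_upwards [ae_restrict_mem measurableSet_Ioo] with t ht using hlim t (Ioo_subset_Icc_self ht)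

theorem theorem3p2_general {E : Set ℝ} {ℓ α e : ℝ → ℝ} {M C : ℝ} {ρ0 : Plane → ℝ}
    {ρin : ℝ → Space3 → ℝ} {ρ : ℝ → ℝ → Space3 → ℝ}
    {u : ℝ → ℝ → Space3 → Vec3} (hℓ_pos : ∀ ε ∈ E, 0 < ℓ ε) (hℓ_lim : Tendsto ℓ (𝓝[E] 0) (𝓝 0))
    (hlam : Tendsto (fun ε => α ε / ℓ ε) (𝓝[E] 0) atTop)
    (hρ0 : IsBetween M ρ0 volume) (hρin : ∀ ε ∈ E, IsBetween M (ρin ε) (slabMeasure (ℓ ε)))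
    (hlim : ∀ ψ, IsTest ψ → Tendsto (fun ε => ∫ y, vAvg (ℓ ε) (ρin ε) y * ψ y) (𝓝[E] 0)
      (𝓝 (∫ y, ρ0 y * ψ y)))
    (hC : ∀ ε ∈ E, (2 * ℓ ε)⁻¹ * e ε ≤ C)
    (hsol : ∀ ε ∈ E, IsFiniteEnergyTransport (ℓ ε) (α ε) (e ε) (ρin ε) (ρ ε) (u ε)) :
    (∀ T : ℝ, 0 < T → TendstoWeakStar E T (fun ε t => vAvg (ℓ ε) (ρ ε t)) ρ0) ∧
    (∃ F : ℝ → ℝ → Plane → ℝ,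
      (∀ ε ∈ E, ∀ᵐ t ∂(volume.restrict (Ioi (0 : ℝ))), F ε t =ᵐ[volume] vAvg (ℓ ε) (ρ ε t)) ∧
      ∀ T : ℝ, 0 < T → ∀ K : Set Plane, IsCompact K → ∀ p : ℝ≥0∞, TendstoCWeak E T K p F ρ0) ∧
    (∀ T : ℝ, 0 < T →
      (∀ ε ∈ E, MemLp (fun q : ℝ × Plane => vAvg (ℓ ε) (u ε q.1) q.2) 2 (planeCylMeasure T)) ∧
      Tendsto (fun ε => eLpNorm (fun q : ℝ × Plane => vAvg (ℓ ε) (u ε q.1) q.2) 2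
        (planeCylMeasure T)) (𝓝[E] 0) (𝓝 0)) := by
  have hu := fun T (hT : 0 < T) => tendsto_meanVelocitySq hℓ_pos hℓ_lim hlam hC hsol hT
  have hvel : ∀ T, 0 < T → ∀ ε ∈ E,
      MemLp (fun q : ℝ × Space3 => u ε q.1 q.2) 2 (cylMeasure (ℓ ε) T) :=
    fun T hT ε hε => (hsol ε hε).memLp_velocity hT
  have hbetween : ∀ T, 0 < T → ∀ ε ∈ E,
      IsBetween M (fun q : ℝ × Plane => vAvg (ℓ ε) (ρ ε q.1) q.2) (planeCylMeasure T) :=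
    fun T hT ε hε =>
      isBetween_vAvg_cyl (hℓ_pos ε hε) ((hsol ε hε).isBetween (hℓ_pos ε hε) (hρin ε hε) hT)
  choose! F hF hFρ hFcont hFinit using fun ε (hε : ε ∈ E) =>
    (hsol ε hε).exists_representative (hℓ_pos ε hε) (hρin ε hε)
  have hunif : ∀ T, 0 < T → ∀ g, Integrable g →
      TendstoUniformlyOn (fun ε t => ∫ y, F ε t y * g y) (fun _ => ∫ y, ρ0 y * g y) (𝓝[E] 0)
        (Icc 0 T) := fun T hT g hg =>
    tendstoUniformlyOn_integral_representative hρ0 hlim (hu T hT) hF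
      (fun ε hε => hFinit ε hε T hT) hg
  refine ⟨fun T hT => ?_, ⟨F, hFρ, fun T hT K hK p => ?_⟩, fun T hT => ⟨fun ε hε => ?_, ?_⟩⟩
  · exact tendstoWeakStar_of_tendsto_representative hρ0 (hbetween T hT) hFρ
      fun t ht g hg => (hunif T hT g hg).tendsto_at ht
  · exact tendstoCWeak_of_tendstoUniformlyOn hF hFcont (hunif T hT) hK p
  · exact (memLp_two_vAvg_cyl (hℓ_pos ε hε) (hvel T hT ε hε)).1
  · exact tendsto_eLpNorm_vAvg hℓ_pos (hvel T hT) (hu T hT)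

theorem theorem3p2
    (E : Set ℝ) (hE : E ⊆ Ioc 0 1) (hE0 : (0 : ℝ) ∈ closure E)
    (ℓ α : ℝ → ℝ) (hℓ_pos : ∀ ε ∈ E, 0 < ℓ ε) (hα_nonneg : ∀ ε ∈ E, 0 ≤ α ε)
    (hℓ_mono : MonotoneOn ℓ E) (hℓ_lim : Tendsto ℓ (𝓝[E] 0) (𝓝 0))
    (hlam : Tendsto (fun ε => α ε / ℓ ε) (𝓝[E] 0) atTop)
    (ρ0 : Plane → ℝ) (rin : ℝ → Space3 → ℝ) (m : ℝ → Space3 → Vec3)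
    (hdata : InitialDataAssumptions E ℓ ρ0 rin m)
    (hρ0 : ¬ ∃ c : ℝ, ∀ y, ρ0 y = c)
    (ρ : ℝ → ℝ → Space3 → ℝ) (u : ℝ → ℝ → Space3 → Vec3)
    (hsol : ∀ ε ∈ E, IsFiniteEnergyWeakSolution ε (ℓ ε) (α ε)
      (initialDensity ρ0 rin ε) (m ε) (ρ ε) (u ε)) :
    -- weak-* convergence of the averaged densities
    (∀ T : ℝ, 0 < T → TendstoWeakStar E T (fun ε t => vAvg (ℓ ε) (ρ ε t)) ρ0) ∧
    -- convergence in `C⁰([0,T]; L^p_w(K))` of the averaged densities, redefined on a null set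
    -- of times
    (∃ F : ℝ → ℝ → Plane → ℝ,
      (∀ ε ∈ E, ∀ᵐ t ∂(volume.restrict (Ioi (0 : ℝ))), F ε t =ᵐ[volume] vAvg (ℓ ε) (ρ ε t)) ∧
      ∀ T : ℝ, 0 < T → ∀ K : Set Plane, IsCompact K → ∀ p : ENNReal, 1 ≤ p → p ≠ ⊤ →
        TendstoCWeak E T K p F ρ0) ∧
    -- strong convergence to zero of the averaged velocities in `L²([0,T]; L²(ℝ²))`
    (∀ T : ℝ, 0 < T →
      (∀ ε ∈ E, MemLp (fun q : ℝ × Plane => vAvg (ℓ ε) (u ε q.1) q.2) 2 (planeCylMeasure T)) ∧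
      Tendsto (fun ε => eLpNorm (fun q : ℝ × Plane => vAvg (ℓ ε) (u ε q.1) q.2) 2
        (planeCylMeasure T)) (𝓝[E] 0) (𝓝 0)) := by
  obtain ⟨M, hM0, hMin⟩ := hdata.exists_isBetween
  obtain ⟨C, hC⟩ := hdata.energy_unif
  obtain ⟨hweak, ⟨F, hF, hcont⟩, hvel⟩ := theorem3p2_general hℓ_pos hℓ_lim hlam hM0 hMin
    (fun ψ hψ => hdata.tendsto_integral_vAvg hℓ_pos hψ.integrable) hC
    fun ε hε => (hsol ε hε).isFiniteEnergyTransport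
  exact ⟨hweak, ⟨F, hF, fun T hT K hK p _ _ => hcont T hT K hK p⟩, hvel⟩
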